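/- An alternating parity tree automaton (APT) is a tuple $\mathcal A=\langle\Sigma,Q,\iota,\delta,\Omega\rangle$ with a finite alphabet $\Sigma$, a finite set of states $Q$, an initial state $\iota\in Q$, a transition function $\delta:Q\times\Sigma\to\mathsf B^+(\{\Diamond,\Box\}\times Q)$ into positive boolean formulas (without constants), and a priority assignment $\Omega:Q\to I$, where $I=\{0,\dots,N\}$ or $I=\{1,\dots,N\}$. Its acceptance game on a labelled infinite tree $t$ (unordered, arbitrary branching, every node has a child) is the parity game with positions $(u,q)$ and $(u,b)$, for $u$ a node, $q$ a state and $b$ a transition condition. Its moves are $(u,q)\to(u,\delta(q,a))$, where $a$ is the label of $u$; $(u,b\vee b')\to(u,b),(u,b')$; $(u,b\wedge b')\to(u,b),(u,b')$; and $(u,\Diamond q)\to(u',q)$ and $(u,\Box q)\to(u',q)$ for every child $u'$ of $u$. Adam owns the positions $(u,\Box q)$ and $(u,b\wedge b')$, and Eve all others; $(u,q)$ has priority $\Omega(q)$ and $(u,b)$ has priority $0$. Eve wins a play iff the highest priority occurring infinitely often is even. $\mathcal A$ accepts $t$ iff Eve has a winning strategy from $(\mathrm{root},\iota)$. It accepts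 a Kripke structure (a finite $\Sigma$-labelled directed graph with an initial vertex in which every vertex has a successor) iff it accepts its tree unfolding. For $k\ge 1$, the register version $\mathcal A_k$ of $\mathcal A$ is the following APT. Its states are the triples $(q,\bar r,o)\in Q\times\{0,\dots,N\}^{k+1}\times\{0,\dots,2k+1\}$, with initial state $(\iota,(0,\dots,0),0)$; the priority of $(q,\bar r,o)$ is $o$. For a register $i\in\{0,\dots,k\}$ and a priority $p$, let $\mathrm{new}_i(\bar r,p)=\bar r'$ with $r'_j=\max(r_j,p)$ for $j>i$, $r'_i=p$, and $r'_j=0$ for $j<i$; let $\mathrm{out}_i(\bar r,p)$ be $2i$ if $\max(r_i,p)$ is even and $2i+1$ otherwise. The transition function is $$\delta'((q,\bar r,o),a)=\bigvee_{i=0}^k\mathrm{move}\big(\delta(q,a),\mathrm{new}_i(\bar r,\Omega(q)),\mathrm{out}_i(\bar r,\Omega(q))\big),$$ where, for $\heartsuit\in\{\Diamond,\Box\}$ and $*\in\{\wedge,\vee\}$, and with $\bar r^i=\mathrm{new}_i(\bar r,0)$ and $o^i=\max(o,\mathrm{out}_i(\bar r,0))$, $$\mathrm{move}(\heartsuit q',\bar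 r,o)=\bigvee_{i=0}^k \heartsuit(q',\bar r^i,o^i),\qquad \mathrm{move}(b*b',\bar r,o)=\bigvee_{i=0}^k\big(\mathrm{move}(b,\bar r^i,o^i)*\mathrm{move}(b',\bar r^i,o^i)\big).$$ **Theorem.** Let $\mathcal A$ be an APT with $n$ states, let $d\in\mathbb N$ (with the convention $\log_2 0=0$), and let $k=1+\lfloor\log_2(dn)\rfloor$. Then $\mathcal A_k$ is an APT with the $2k+2$ priorities $0,\dots,2k+1$, and it is equivalent to $\mathcal A$ with respect to Kripke structures in which the subgraph induced by each strongly connected component has a minimum feedback vertex set (a set of vertices meeting every directed cycle) of size at most $d$. That is, for every such Kripke structure $S$, $\mathcal A$ accepts $S$ if and only if $\mathcal A_k$ accepts $S$. -/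

import Mathlib

universe u v w

/-! ## Parity games -/

/-- Parity games on a possibly infinite arena. Positions that are not in `eve` belong to Adam;
every position has a successor, and the priorities lie in a finite set. -/
structure ParityGame where
  Pos : Type u
  eve : Set Pos
  edge : Pos → Pos → Prop
  priority : Pos → ℕ
  total : ∀ x, ∃ y, edge x y
  bounded : ∃ N, ∀ x, priority x ≤ N

namespace ParityGame

variable (G : ParityGame.{u})

/-- A play is an infinite path in the arena. -/
def IsPlay (π : ℕ → G.Pos) : Prop := ∀ i, G.edge (π i) (π (i + 1))

/-- The highest priority that occurs infinitely often along `π` is even. -/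
def EveWinsPlay (π : ℕ → G.Pos) : Prop :=
  ∃ p, IsGreatest {p | ∃ᶠ i in Filter.atTop, G.priority (π i) = p} p ∧ Even p

/-- Positional strategies for Eve: the values outside `eve` are irrelevant. -/
def IsEveStrategy (σ : G.Pos → G.Pos) : Prop := ∀ x ∈ G.eve, G.edge x (σ x)

/-- The play `π` agrees with the strategy `σ` of Eve. -/
def Agrees (σ : G.Pos → G.Pos) (π : ℕ → G.Pos) : Prop :=
  ∀ i, π i ∈ G.eve → π (i + 1) = σ (π i)

/-- Eve has a (positional) strategy that is winning from the position `x`. -/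
def EveWinsFrom (x : G.Pos) : Prop :=
  ∃ σ, G.IsEveStrategy σ ∧
    ∀ π, G.IsPlay π → π 0 = x → G.Agrees σ π → G.EveWinsPlay π

end ParityGame

/-! ## Labelled graphs, Kripke structures and their tree unfoldings -/

/-- A graph with labels in `α`, an initial vertex, and at least one successor for every vertex.
A Kripke structure is such a graph with finitely many vertices; an infinite rooted labelled tree
is also such a graph. -/
structure LabelledGraph (α : Type u) where
  V : Type w
  Adj : V → V → Prop
  label : V → α
  root : V
  total : ∀ x, ∃ y, Adj x y

namespace LabelledGraph

variable {α : Type u} (S : LabelledGraph.{u, w} α)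

/-- The nonempty finite paths of `S` that start in the root, listed from the last vertex
back to the root. -/
inductive IsRootedPath : List S.V → Prop
  | root : IsRootedPath [S.root]
  | step {x y : S.V} {l : List S.V} :
      IsRootedPath (x :: l) → S.Adj x y → IsRootedPath (y :: x :: l)

theorem IsRootedPath.ne_nil {S : LabelledGraph.{u, w} α} {l : List S.V}
    (h : S.IsRootedPath l) : l ≠ [] := by
  cases h <;> simp

/-- The tree unfolding of `S`: its nodes are the finite paths from the root, the children of a
path are its one-step extensions, and a path carries the label of its last vertex. -/
def unfolding : LabelledGraph.{u, w} α where
  V := {l : List S.V // S.IsRootedPath l}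
  Adj l l' := ∃ y, l'.1 = y :: l.1
  label l := S.label (l.1.head l.2.ne_nil)
  root := ⟨[S.root], .root⟩
  total := by
    rintro ⟨l, hl⟩
    cases hl with
    | root =>
      obtain ⟨y, hy⟩ := S.total S.root
      exact ⟨⟨_, .step .root hy⟩, y, rfl⟩
    | @step a x l h hx =>
      obtain ⟨y, hy⟩ := S.total x
      exact ⟨⟨_, .step (.step h hx) hy⟩, y, rfl⟩

/-- The (maximal) strongly connected component of a vertex. -/
def scc (x : S.V) : Set S.V :=
  {y | Relation.ReflTransGen S.Adj x y ∧ Relation.ReflTransGen S.Adj y x}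

end LabelledGraph

/-- The directed cycles of a graph, as cyclic lists of pairwise distinct vertices.
A self-loop is a cycle of length one. -/
def IsDirectedCycle {V : Type w} (E : V → V → Prop) (c : Cycle V) : Prop :=
  c ≠ Cycle.nil ∧ c.Nodup ∧ c.Chain E

/-- `F` contains at least one vertex of every cycle. -/
def IsFeedbackVertexSet {V : Type w} (E : V → V → Prop) (F : Set V) : Prop :=
  ∀ c, IsDirectedCycle E c → ∃ x ∈ c, x ∈ F

/-- The size of a minimum feedback vertex set (of a finite graph). -/
noncomputable def fvsSize {V : Type w} (E : V → V → Prop) : ℕ :=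
  sInf {m | ∃ F : Finset V, F.card = m ∧ IsFeedbackVertexSet E (F : Set V)}

/-- The minimum feedback vertex set of the subgraph induced by any strongly connected component
has size at most `d`. -/
def LabelledGraph.SCCsHaveFvsSizeAtMost {α : Type u} (S : LabelledGraph.{u, w} α) (d : ℕ) : Prop :=
  ∀ x : S.V, fvsSize (fun a b : S.scc x => S.Adj a b) ≤ d

/-! ## Alternating parity tree automata -/

/-- Positive boolean formulas (without constants). -/
inductive PosBool (X : Type u) : Type u
  | atom : X → PosBool X
  | and : PosBool X → PosBool X → PosBool X
  | or : PosBool X → PosBool X → PosBool X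

/-- The disjunction of `f 0, …, f k`. -/
def PosBool.bigOr {X : Type u} : (k : ℕ) → (Fin (k + 1) → PosBool X) → PosBool X
  | 0, f => f 0
  | k + 1, f => .or (f 0) (bigOr k fun i => f i.succ)

/-- The path quantifiers `◇` and `□`. -/
inductive PathQuantifier
  | dia
  | box

/-- Transition conditions over the set of states `Q`. -/
abbrev TransitionCondition (Q : Type v) := PosBool (PathQuantifier × Q)

/-- Alternating parity tree automata over the alphabet `α`. The priorities are taken from
`{minPriority, …, maxPriority}`. -/
structure APT (α : Type u) where
  State : Type v
  finite : Finite State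
  init : State
  trans : State → α → TransitionCondition State
  minPriority : ℕ
  maxPriority : ℕ
  priority : State → ℕ
  minPriority_le_one : minPriority ≤ 1
  minPriority_le : ∀ q, minPriority ≤ priority q
  le_maxPriority : ∀ q, priority q ≤ maxPriority

namespace APT

variable {α : Type u}

/-- The number of states. -/
noncomputable def numStates (A : APT.{u, v} α) : ℕ := Nat.card A.State

/-- The number of priorities. -/
def numPriorities (A : APT.{u, v} α) : ℕ := A.maxPriority + 1 - A.minPriority

/-- The moves of the acceptance game. -/
inductive Move (A : APT.{u, v} α) (t : LabelledGraph.{u, w} α) :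
    t.V × (A.State ⊕ TransitionCondition A.State) →
    t.V × (A.State ⊕ TransitionCondition A.State) → Prop
  | state (x q) : Move A t (x, .inl q) (x, .inr (A.trans q (t.label x)))
  | or_left (x b b') : Move A t (x, .inr (.or b b')) (x, .inr b)
  | or_right (x b b') : Move A t (x, .inr (.or b b')) (x, .inr b')
  | and_left (x b b') : Move A t (x, .inr (.and b b')) (x, .inr b)
  | and_right (x b b') : Move A t (x, .inr (.and b b')) (x, .inr b')
  | child (x y m q) : t.Adj x y → Move A t (x, .inr (.atom (m, q))) (y, .inl q)

/-- The positions `□ q` and `b ∧ b'` belong to Adam, all others to Eve. -/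
def IsEve (A : APT.{u, v} α) : A.State ⊕ TransitionCondition A.State → Prop
  | .inr (.atom (.box, _)) => False
  | .inr (.and _ _) => False
  | _ => True

/-- States carry their own priority, transition conditions have priority `0`. -/
def positionPriority (A : APT.{u, v} α) : A.State ⊕ TransitionCondition A.State → ℕ
  | .inl q => A.priority q
  | .inr _ => 0

/-- The acceptance game of `A` on a tree `t`; a node stands for the subtree below it. -/
def acceptanceGame (A : APT.{u, v} α) (t : LabelledGraph.{u, w} α) : ParityGame where
  Pos := t.V × (A.State ⊕ TransitionCondition A.State)
  eve := {x | A.IsEve x.2}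
  edge := A.Move t
  priority x := A.positionPriority x.2
  total := by
    rintro ⟨x, q | ⟨⟨m, q⟩⟩ | ⟨b, b'⟩ | ⟨b, b'⟩⟩
    · exact ⟨_, .state x q⟩
    · obtain ⟨y, hy⟩ := t.total x
      exact ⟨_, .child x y m q hy⟩
    · exact ⟨_, .and_left x b b'⟩
    · exact ⟨_, .or_left x b b'⟩
  bounded := by
    refine ⟨A.maxPriority, ?_⟩
    rintro ⟨x, q | b⟩
    · exact A.le_maxPriority q
    · exact Nat.zero_le _

/-- Acceptance of a tree. -/
def AcceptsTree (A : APT.{u, v} α) (t : LabelledGraph.{u, w} α) : Prop :=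
  (A.acceptanceGame t).EveWinsFrom (t.root, .inl A.init)

/-- Acceptance of a Kripke structure: acceptance of its tree unfolding. -/
def Accepts (A : APT.{u, v} α) (S : LabelledGraph.{u, w} α) : Prop :=
  A.AcceptsTree S.unfolding

end APT

/-! ## The parameterised (register) version of an automaton -/

/-- Contents in `{0, …, N}` of the registers `r_0, …, r_k`. -/
abbrev Registers (k N : ℕ) := Fin (k + 1) → Fin (N + 1)

namespace Registers

variable {k N : ℕ}

/-- The registers after Eve has chosen register `i` when the priority `p` is seen. -/
def update (r : Registers k N) (i : Fin (k + 1)) (p : Fin (N + 1)) : Registers k N := fun j =>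
  if i < j then max (r j) p else if j = i then p else 0

/-- The output when Eve chooses register `i` and the priority `p` is seen: `2 i` if
`max (r_i) p` is even, and `2 i + 1` otherwise. -/
def output (r : Registers k N) (i : Fin (k + 1)) (p : Fin (N + 1)) : Fin (2 * k + 2) :=
  if Even (max (r i) p : Fin (N + 1)).val then ⟨2 * i.val, by omega⟩
  else ⟨2 * i.val + 1, by omega⟩

end Registers

namespace APT

variable {α : Type u}

/-- States of the parameterised version: a state, the register contents, and the largest output
since the previous state. -/
abbrev RegState (A : APT.{u, v} α) (k : ℕ) : Type v :=
  A.State × Registers k A.maxPriority × Fin (2 * k + 2)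

/-- The transition condition that simulates `b` with register contents `r`, where `o` is the
largest output since the last state. At each subformula (of priority `0`) Eve first chooses
a register. -/
def simulate (A : APT.{u, v} α) (k : ℕ) :
    TransitionCondition A.State → Registers k A.maxPriority → Fin (2 * k + 2) →
      TransitionCondition (A.RegState k)
  | .atom (m, q), r, o =>
      PosBool.bigOr k fun i => .atom (m, (q, r.update i 0, max o (r.output i 0)))
  | .and b b', r, o =>
      PosBool.bigOr k fun i =>
        .and (simulate A k b (r.update i 0) (max o (r.output i 0)))
          (simulate A k b' (r.update i 0) (max o (r.output i 0)))
  | .or b b', r, o =>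
      PosBool.bigOr k fun i =>
        .or (simulate A k b (r.update i 0) (max o (r.output i 0)))
          (simulate A k b' (r.update i 0) (max o (r.output i 0)))

/-- The priority of a state as a register content. -/
def regPriority (A : APT.{u, v} α) (q : A.State) : Fin (A.maxPriority + 1) :=
  ⟨A.priority q, Nat.lt_succ_of_le (A.le_maxPriority q)⟩

/-- The `k`-parameterised version `A_k` of the automaton `A`. -/
def registerVersion (A : APT.{u, v} α) (k : ℕ) : APT.{u, v} α where
  State := A.RegState k
  finite := by
    have := A.finite
    infer_instance
  init := (A.init, fun _ => 0, 0)
  trans := fun s a =>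
    PosBool.bigOr k fun i =>
      A.simulate k (A.trans s.1 a) (s.2.1.update i (A.regPriority s.1))
        (s.2.1.output i (A.regPriority s.1))
  minPriority := 0
  maxPriority := 2 * k + 1
  priority := fun s => s.2.2.val
  minPriority_le_one := Nat.zero_le _
  minPriority_le := fun _ => Nat.zero_le _
  le_maxPriority := fun s => Nat.le_of_lt_succ s.2.2.isLt

end APT

/-! The implication from `A_k` to `A` holds on every tree and for every `k`. If the outputs have the
even limit `2 i`, then from some point on no register above `i` is chosen, and register `i` is
chosen infinitely often, each time with an even maximum. Since register `i` holds the highest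
priority since its last choice, one of these maxima is the limit priority of the play, which is
therefore even (`Registers.hasEvenLimit_of_output`).

For the converse, the game is played on the finite graph instead of its unfolding
(`acceptsTree_unfolding`). In the graph of moves of a winning strategy, let `C(v)` be the strongly
connected component of `v` among the positions of priority at most that of `v`. Eve chooses at `v`
the register whose index is the bit length of the number of feedback positions in `C(v)`. These are
states of `A` at feedback vertices of `S`; as `C(v)` projects into a single component of `S`, there
are at most `d n < 2 ^ k` of them, so `k + 1` registers suffice.

Along a play, let `x₀` be a recurrent state of maximal recurrent priority. Eventually the play stays
in `C(x₀)`, all components met are subsets of it, and no register above `I`, the register of `x₀`,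
is chosen. Two positions that choose `I` have components with at least `2 ^ (I - 1)` feedback
positions each, inside a set with fewer than `2 ^ I`; hence the components meet, and the segment of
the play between the positions closes up to a cycle without exceeding the priorities on the segment.
The strategy is winning, so the highest priority on this cycle is even, and register `I` outputs `2
I` (`hasEvenLimit_output_of_size`).

Strategies are handled through progress measures: a graph without bad infinite paths has
well-founded measures for all odd priorities (`exists_progress`), and a strategy with memory that
carries such measures can be made positional by minimising them lexicographically
(`eveWinsFrom_of_progress`). The memory consists of register contents or of nodes of the unfolding.
-/

open Filter Relation

/-! ## Limit priorities of sequences -/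

/-- `p` is the highest value that occurs infinitely often in the sequence `a`, and no higher value
occurs from some point on. -/
def IsLimitPriority (a : ℕ → ℕ) (p : ℕ) : Prop :=
  (∃ᶠ i in atTop, a i = p) ∧ ∀ᶠ i in atTop, a i ≤ p

theorem exists_isLimitPriority {a : ℕ → ℕ} {N : ℕ} (h : ∀ i, a i ≤ N) :
    ∃ p, IsLimitPriority a p := by
  classical
  have hex : ∃ p, ∀ᶠ i in atTop, a i ≤ p := ⟨N, Eventually.of_forall h⟩
  refine ⟨Nat.find hex, ?_, Nat.find_spec hex⟩
  intro hne
  have hlt : ∀ᶠ i in atTop, a i < Nat.find hex := by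
    filter_upwards [hne, Nat.find_spec hex] with i h1 h2
    exact lt_of_le_of_ne h2 h1
  rcases Nat.eq_zero_or_pos (Nat.find hex) with h0 | hpos
  · obtain ⟨i, hi⟩ := hlt.exists
    omega
  · refine Nat.find_min hex (m := Nat.find hex - 1) (by omega) ?_
    filter_upwards [hlt] with i hi
    omega

theorem IsLimitPriority.isGreatest {a : ℕ → ℕ} {p : ℕ} (h : IsLimitPriority a p) :
    IsGreatest {p | ∃ᶠ i in atTop, a i = p} p := by
  refine ⟨h.1, fun q hq => ?_⟩
  obtain ⟨i, hi, hi'⟩ := (Frequently.and_eventually hq h.2).exists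
  omega

/-- Two sequences with different values can be compared through thresholds that are passed
infinitely often; this is how accumulated outputs are treated. -/
theorem isLimitPriority_iff_frequently_le {a : ℕ → ℕ} {p : ℕ} :
    IsLimitPriority a p ↔ (∃ᶠ i in atTop, p ≤ a i) ∧ ¬ ∃ᶠ i in atTop, p + 1 ≤ a i := by
  rw [not_frequently]
  constructor
  · rintro ⟨h1, h2⟩
    exact ⟨h1.mono fun i hi => hi.ge, h2.mono fun i hi => by omega⟩
  · rintro ⟨h1, h2⟩
    exact ⟨(h1.and_eventually h2).mono fun i hi => by omega, h2.mono fun i hi => by omega⟩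

/-- The highest value that occurs infinitely often is even. -/
def HasEvenLimit (a : ℕ → ℕ) : Prop := ∃ p, IsLimitPriority a p ∧ Even p

/-- A sequence of priorities has an even limit if every odd priority `p` is witnessed by a measure
that does not increase at priorities up to `p` and decreases at priority `p`. -/
theorem hasEvenLimit_of_measure {a : ℕ → ℕ} {N : ℕ} (hN : ∀ i, a i ≤ N) {β : Type v}
    [Preorder β] [WellFoundedLT β] (m : ℕ → ℕ → β)
    (hm : ∀ p, Odd p → ∀ t, a t ≤ p → m p (t + 1) ≤ m p t)
    (hm' : ∀ p, Odd p → ∀ t, a t = p → m p (t + 1) < m p t) : HasEvenLimit a := by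
  obtain ⟨p, hp⟩ := exists_isLimitPriority hN
  refine ⟨p, hp, ?_⟩
  by_contra hodd
  rw [Nat.not_even_iff_odd] at hodd
  obtain ⟨T, hT⟩ := eventually_atTop.1 hp.2
  -- Past `T` the measure of `p` never increases, so a minimal value taken there is contradicted by
  -- the next occurrence of `p`.
  obtain ⟨_, ⟨t₀, ht₀, rfl⟩, hmin⟩ := (wellFounded_lt (α := β)).has_min
    {b | ∃ t, T ≤ t ∧ m p t = b} ⟨_, T, le_rfl, rfl⟩
  obtain ⟨t₁, ht₁, hpt⟩ := frequently_atTop.1 hp.1 t₀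
  have hanti : ∀ t, t₀ ≤ t → m p t ≤ m p t₀ := by
    intro t ht
    induction t, ht using Nat.le_induction with
    | base => exact le_rfl
    | succ t ht ih => exact (hm p hodd t (hT t (ht₀.trans ht))).trans ih
  exact hmin _ ⟨t₁ + 1, by omega, rfl⟩ ((hm' p hodd t₁ hpt).trans_le (hanti t₁ ht₁))

/-! ## Progress measures -/

/-- Along a step from `x` to `y`, the measures of the odd priorities do not increase at priorities
at least that of `x`, and the measure of the priority of `x` decreases. -/
def Progress {X : Type u} (pr : X → ℕ) (μ : ℕ → X → Ordinal.{v}) (x y : X) : Prop :=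
  ∀ p, Odd p → pr x ≤ p → μ p y ≤ μ p x ∧ (pr x = p → μ p y < μ p x)

theorem hasEvenLimit_of_progress {X : Type u} {pr : X → ℕ} {μ : ℕ → X → Ordinal.{v}} {N : ℕ}
    (hN : ∀ x, pr x ≤ N) {π : ℕ → X} (h : ∀ i, Progress pr μ (π i) (π (i + 1))) :
    HasEvenLimit fun i => pr (π i) :=
  hasEvenLimit_of_measure (fun _ => hN _) (fun p t => μ p (π t))
    (fun p hp t ht => (h t p hp ht).1) (fun p hp t ht => (h t p hp ht.le).2 ht)

/-- An infinite path visits a set infinitely often if from every vertex of a set `B` without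
dead ends the set can be reached inside `B`. -/
theorem exists_path_frequently {X : Type u} {r : X → X → Prop} {B M : Set X} (hB : B.Nonempty)
    (hreach : ∀ x ∈ B, ∃ z ∈ B, z ∈ M ∧ ReflTransGen (fun a b => r a b ∧ b ∈ B) x z)
    (hstep : ∀ x ∈ B, ∃ y ∈ B, r x y) :
    ∃ π : ℕ → X, (∀ i, r (π i) (π (i + 1))) ∧ ∃ᶠ i in atTop, π i ∈ M := by
  -- The path follows decreasing distance to `M` inside `B`; at distance `0` any step inside `B`
  -- starts the next descent.
  let Reach : ℕ → X → Prop := fun n =>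
    Nat.rec (fun x => x ∈ M) (fun _ P x => ∃ y ∈ B, r x y ∧ P y) n
  have hex : ∀ x : B, ∃ n, Reach n x := by
    rintro ⟨x, hx⟩
    obtain ⟨z, -, hzM, hxz⟩ := hreach x hx
    change ∃ n, Reach n x
    clear hx
    induction hxz using ReflTransGen.head_induction_on with
    | refl => exact ⟨0, hzM⟩
    | head h _ ih =>
      obtain ⟨n, hn⟩ := ih
      exact ⟨n + 1, _, h.2, h.1, hn⟩
  let D : B → ℕ := fun x => @Nat.find (fun n => Reach n x) (Classical.decPred _) (hex x)
  have hnext : ∀ x : B, ∃ y : B, r x y ∧ (D x = 0 ∨ D y < D x) := by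
    intro x
    have hs : Reach (D x) x 
      := @Nat.find_spec _ (Classical.decPred _) (hex x)
    rcases hD : D x with _ | n
    · obtain ⟨y, hy, hxy⟩ := hstep x x.2
      exact ⟨⟨y, hy⟩, hxy, .inl rfl⟩
    · rw [hD] at hs
      obtain ⟨y, hy, hxy, hyn⟩ := hs
      exact ⟨⟨y, hy⟩, hxy, .inr (Nat.lt_succ_of_le 
        (@Nat.find_min' _ (Classical.decPred _) (hex ⟨y, hy⟩) n hyn))⟩
  choose next hr hD using hnext
  obtain ⟨x₀, hx₀⟩ := hB
  let π : ℕ → B := fun n => next^[n] ⟨x₀, hx₀⟩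
  have hπ : ∀ n, π (n + 1) = next (π n) := fun n => Function.iterate_succ_apply' next n _
  have hzero : ∀ n t, D (π t) ≤ n → ∃ s, t ≤ s ∧ D (π s) = 0 := by
    intro n
    induction n with
    | zero => exact fun t ht => ⟨t, le_rfl, by omega⟩
    | succ n ih =>
      intro t ht
      rcases hD (π t) with h | h
      · exact ⟨t, le_rfl, h⟩
      · obtain ⟨s, hs, hs'⟩ := ih (t + 1) (by rw [hπ]; omega)
        exact ⟨s, by omega, hs'⟩
  refine ⟨fun n => π n, fun i => ?_, frequently_atTop.2 fun t => ?_⟩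
  · change r (π i) (π (i + 1))
    rw [hπ]
    exact hr _
  · obtain ⟨s, hs, hs'⟩ := hzero _ t le_rfl
    have hspec : Reach (D (π s)) (π s) 
      := @Nat.find_spec _ (Classical.decPred _) (hex (π s))
    rw [hs'] at hspec
    exact ⟨s, hs, hspec⟩

/-- A graph all of whose infinite paths have an even limit priority has a progress measure. -/
theorem exists_progress {X : Type u} {R : X → X → Prop} {pr : X → ℕ}
    (h : ∀ π : ℕ → X, (∀ i, R (π i) (π (i + 1))) → HasEvenLimit fun i => pr (π i)) :
    ∃ μ : ℕ → X → Ordinal.{u}, ∀ x y, R x y → Progress pr μ x y := by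
  let r : ℕ → X → X → Prop := fun p x y => R x y ∧ pr x ≤ p
  -- A descent is a path through sources of priority at most `p` that leaves a vertex of priority
  -- exactly `p`. The measure of `p` will be the rank of this relation.
  let desc : ℕ → X → X → Prop := fun p y x =>
    ∃ z z', ReflTransGen (r p) x z ∧ pr z = p ∧ r p z z' ∧ ReflTransGen (r p) z' y
  have hwf : ∀ p, Odd p → WellFounded (desc p) := by
    intro p hp
    by_contra hnwf
    let B : Set X := {x | ¬ Acc (desc p) x}
    have hBne : B.Nonempty := by
      by_contra hemp
      exact hnwf ⟨fun x => by_contra fun hx => hemp ⟨x, hx⟩⟩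
    -- Each descent from `y` extends backwards to one from `x`. Thus `B` contains the whole of every
    -- descent that ends in it, and descents can be chained inside `B` to a path with odd limit `p`.
    have hback : ∀ x y, r p x y → y ∈ B → x ∈ B := by
      intro x y hxy hy hacc
      refine hy ⟨y, fun w hw => ?_⟩
      obtain ⟨z, z', h1, h2, h3, h4⟩ := hw
      exact hacc.inv ⟨z, z', h1.head hxy, h2, h3, h4⟩
    have hback' : ∀ x y, ReflTransGen (r p) x y → y ∈ B →
        x ∈ B ∧ ReflTransGen (fun a b => r p a b ∧ b ∈ B) x y := by
      intro x y hxy hy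
      induction hxy using ReflTransGen.head_induction_on with
      | refl => exact ⟨hy, .refl⟩
      | head h _ ih => exact ⟨hback _ _ h ih.1, ih.2.head ⟨h, ih.1⟩⟩
    have hdesc : ∀ x ∈ B, ∃ y ∈ B, desc p y x := by
      intro x hx
      by_contra hcon
      push Not at hcon
      exact hx ⟨x, fun y hy => by_contra fun hy' => hcon y hy' hy⟩
    obtain ⟨π, hπ, hfreq⟩ := exists_path_frequently (r := r p) (M := {x | pr x = p}) hBne
      (by
        intro x hx
        obtain ⟨y, hy, z, z', h1, h2, h3, h4⟩ := hdesc x hx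
        have hz := hback _ _ h3 (hback' _ _ h4 hy).1
        exact ⟨z, hz, h2, (hback' _ _ h1 hz).2⟩)
      (by
        intro x hx
        obtain ⟨y, hy, z, z', h1, h2, h3, h4⟩ := hdesc x hx
        have hz' := (hback' _ _ h4 hy).1
        rcases h1.cases_head with rfl | ⟨w, hxw, hwz⟩
        · exact ⟨z', hz', h3⟩
        · exact ⟨w, (hback' _ _ hwz (hback _ _ h3 hz')).1, hxw⟩)
    obtain ⟨q, hq, heven⟩ := h π fun i => (hπ i).1
    have hlim : IsLimitPriority (fun i => pr (π i)) p :=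
      ⟨hfreq, Eventually.of_forall fun i => (hπ i).2⟩
    rw [hq.isGreatest.unique hlim.isGreatest] at heven
    exact Nat.not_even_iff_odd.2 hp heven
  refine ⟨fun p x => if hp : Odd p then ((hwf p hp).apply x).rank else 0,
    fun x y hxy p hp hle => ?_⟩
  simp only [dif_pos hp]
  constructor
  · rw [Acc.rank_eq ((hwf p hp).apply y)]
    refine Ordinal.iSup_le fun ⟨z, w, w', h1, h2, h3, h4⟩ => Order.succ_le_of_lt ?_
    exact ((hwf p hp).apply x).rank_lt_of_rel ⟨w, w', h1.head ⟨hxy, hle⟩, h2, h3, h4⟩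
  · rintro hpx
    exact ((hwf p hp).apply x).rank_lt_of_rel ⟨x, y, .refl, hpx, ⟨hxy, hle⟩, .refl⟩

/-! ## Positional strategies from progress measures -/

namespace ParityGame

variable (G : ParityGame.{u})

theorem eveWinsPlay_iff (π : ℕ → G.Pos) :
    G.EveWinsPlay π ↔ HasEvenLimit fun i => G.priority (π i) := by
  constructor
  · rintro ⟨p, hp, he⟩
    obtain ⟨N, hN⟩ := G.bounded
    obtain ⟨q, hq⟩ := exists_isLimitPriority (a := fun i => G.priority (π i)) fun i => hN _
    rw [hp.unique hq.isGreatest] at he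
    exact ⟨q, hq, he⟩
  · rintro ⟨p, hp, he⟩
    exact ⟨p, hp.isGreatest, he⟩

theorem eveWinsPlay_succ (π : ℕ → G.Pos) :
    G.EveWinsPlay (fun i => π (i + 1)) ↔ G.EveWinsPlay π := by
  have h : ∀ p, (∃ᶠ i in atTop, G.priority (π (i + 1)) = p) ↔
      ∃ᶠ i in atTop, G.priority (π i) = p := by
    intro p
    conv_rhs => rw [← map_add_atTop_eq_nat 1]
    exact (frequently_map (f := atTop) (m := fun a => a + 1)
      (P := fun i => G.priority (π i) = p)).symm
  unfold EveWinsPlay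
  simp only [h]

/-- Eve can move from `a` to `b`, by a path through positions of her own of priority `0`. -/
def EveReach : G.Pos → G.Pos → Prop :=
  ReflTransGen fun a b => a ∈ G.eve ∧ G.priority a = 0 ∧ G.edge a b

/-- The entries of a tuple of measures for the priorities at least `p`. -/
def truncate {N : ℕ} (p : ℕ) (m : Lex ((Fin (N + 1))ᵒᵈ → Ordinal.{v})) :
    Lex ((Fin (N + 1))ᵒᵈ → Ordinal.{v}) :=
  toLex fun q => if p ≤ (OrderDual.ofDual q).val then ofLex m q else 0

/-- The dual order on indices puts high priorities first, so truncation erases only the least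
significant entries of the lexicographic order. -/
theorem truncate_mono {N : ℕ} (p : ℕ) :
    Monotone (truncate.{v} (N := N) p) := by
  intro a b hab
  rcases hab.eq_or_lt with rfl | hlt
  · exact le_rfl
  obtain ⟨i, hi, hi'⟩ := hlt
  by_cases hp : p ≤ (OrderDual.ofDual i).val
  · refine le_of_lt ⟨i, fun j hj => ?_, ?_⟩
    · have := hi j hj
      simp only [truncate]
      change (if _ then a j else 0) = (if _ then b j else 0)
      rw [this]
    · change (if _ then a i else 0) < (if _ then b i else 0)
      rwa [if_pos hp, if_pos hp]
  · refine le_of_eq (congrArg toLex (funext fun j => ?_))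
    split_ifs with hj
    · refine hi j ?_
      change j < i
      rw [← OrderDual.ofDual_lt_ofDual, Fin.lt_def]
      omega
    · rfl

/-- Eve wins positionally from every position of a (multi-valued) strategy that has a progress
measure. Between the positions of the strategy she may pass through positions of priority `0`. -/
theorem eveWinsFrom_of_progress {X : Type w} (f : X → G.Pos) (μ : ℕ → X → Ordinal.{v})
    (heve : ∀ x, f x ∈ G.eve → ∃ b y, G.edge (f x) b ∧ G.EveReach b (f y) ∧
      Progress (fun x => G.priority (f x)) μ x y)
    (hadam : ∀ x, f x ∉ G.eve → ∀ b, G.edge (f x) b → ∃ y, G.EveReach b (f y) ∧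
      Progress (fun x => G.priority (f x)) μ x y)
    {a : G.Pos} {x : X} (hax : G.EveReach a (f x)) : G.EveWinsFrom a := by
  obtain ⟨N, hN⟩ := G.bounded
  -- Higher priorities are more significant; the entries of even priorities play no role and are set
  -- to `0`.
  let m : X → Lex ((Fin (N + 1))ᵒᵈ → Ordinal.{v}) := fun x =>
    toLex fun q => if Odd (OrderDual.ofDual q).val then μ (OrderDual.ofDual q).val x else 0
  let D : Set G.Pos := {a | ∃ x, G.EveReach a (f x)}
  -- The choice of a minimal `x` for each position removes the memory. Replacing a successor by the
  -- minimal one lowers the tuple further, and this survives truncation by `truncate_mono`.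
  have hmin : ∀ a, ∃ x, a ∈ D → G.EveReach a (f x) ∧ ∀ y, G.EveReach a (f y) → m x ≤ m y := by
    intro a
    by_cases ha : a ∈ D
    · obtain ⟨_, ⟨x, hx, rfl⟩, hx'⟩ := (wellFounded_lt
        (α := Lex ((Fin (N + 1))ᵒᵈ → Ordinal.{v}))).has_min
        (m '' {x | G.EveReach a (f x)}) (Set.Nonempty.image _ ha)
      exact ⟨x, fun _ => ⟨hx, fun y hy => not_lt.1 (hx' _ ⟨y, hy, rfl⟩)⟩⟩
    · exact ⟨x, fun h => absurd h ha⟩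
  choose ξ hξ using hmin
  have hprog : ∀ x y, Progress (fun x => G.priority (f x)) μ x y → ∀ p, Odd p →
      (G.priority (f x) ≤ p → truncate p (m y) ≤ truncate p (m x)) ∧
      (G.priority (f x) = p → truncate p (m y) < truncate p (m x)) := by
    intro x y hxy p hp
    have hle : G.priority (f x) ≤ p → ∀ q : (Fin (N + 1))ᵒᵈ,
        ofLex (truncate p (m y)) q ≤ ofLex (truncate p (m x)) q := by
      intro hxp q
      change (if _ then (if _ then _ else _) else _) ≤ (if _ then (if _ then _ else _) else _)
      split_ifs with h1 h2
      · exact (hxy _ h2 (hxp.trans h1)).1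
      · exact le_rfl
      · exact le_rfl
    refine ⟨fun hxp => Pi.toLex_monotone (hle hxp), fun hxp => ?_⟩
    refine Pi.toLex_strictMono (Pi.lt_def.2 ⟨hle hxp.le, OrderDual.toDual ⟨p, ?_⟩, ?_⟩)
    · have := hN (f x)
      omega
    · change (if p ≤ p then (if Odd p then _ else _) else _) <
        (if p ≤ p then (if Odd p then _ else _) else _)
      rw [if_pos le_rfl, if_pos hp, if_pos le_rfl, if_pos hp]
      exact (hxy p hp hxp.le).2 hxp
  let P : G.Pos → G.Pos → Prop := fun a b => b ∈ D ∧ ∀ p, Odd p →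
    (G.priority a ≤ p → truncate p (m (ξ b)) ≤ truncate p (m (ξ a))) ∧
    (G.priority a = p → truncate p (m (ξ b)) < truncate p (m (ξ a)))
  have hP : ∀ a ∈ D, ∀ b y, f (ξ a) = a → G.EveReach b (f y) →
      Progress (fun x => G.priority (f x)) μ (ξ a) y → P a b := by
    intro a ha b y hfa hby hprog'
    have hb : b ∈ D := ⟨y, hby⟩
    refine ⟨hb, fun p hp => ?_⟩
    have h1 := hprog _ _ hprog' p hp
    rw [hfa] at h1
    have h2 := truncate_mono p ((hξ b hb).2 y hby)
    exact ⟨fun h => h2.trans (h1.1 h), fun h => h2.trans_lt (h1.2 h)⟩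
  have hstep : ∀ a ∈ D, (a ∈ G.eve → ∃ b, G.edge a b ∧ P a b) ∧
      (a ∉ G.eve → ∀ b, G.edge a b → P a b) := by
    intro a ha
    -- Either `a` is already the position of `ξ a`, or Eve is still on her way there. In the latter
    -- case the priority is `0`, which is not odd, so no strict decrease is needed.
    rcases (hξ a ha).1.cases_head with heq | ⟨b, ⟨hae, hap, hab⟩, hb⟩
    · constructor
      · intro hae
        obtain ⟨b, y, hab, hby, hpr⟩ := heve (ξ a) (heq ▸ hae)
        exact ⟨b, heq ▸ hab, hP a ha b y heq.symm hby hpr⟩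
      · intro hae b hab
        obtain ⟨y, hby, hpr⟩ := hadam (ξ a) (heq ▸ hae) b (heq ▸ hab)
        exact hP a ha b y heq.symm hby hpr
    · refine ⟨fun _ => ⟨b, hab, ⟨_, hb⟩, fun p hp => ?_⟩, fun h => absurd hae h⟩
      refine ⟨fun _ => truncate_mono p ((hξ b ⟨_, hb⟩).2 _ hb), fun h => ?_⟩
      rw [hap] at h
      exact absurd hp (by rw [← h]; decide)
  have hσ : ∀ a, ∃ b, G.edge a b ∧ (a ∈ D → a ∈ G.eve → P a b) := by
    intro a
    by_cases h : a ∈ D ∧ a ∈ G.eve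
    · obtain ⟨b, hb⟩ := (hstep a h.1).1 h.2
      exact ⟨b, hb.1, fun _ _ => hb.2⟩
    · obtain ⟨b, hb⟩ := G.total a
      exact ⟨b, hb, fun h1 h2 => absurd ⟨h1, h2⟩ h⟩
  choose σ hσ using hσ
  refine ⟨σ, fun a _ => (hσ a).1, fun π hπ hπ0 hag => ?_⟩
  have hPstep : ∀ i, π i ∈ D → P (π i) (π (i + 1)) := by
    intro i hi
    by_cases he : π i ∈ G.eve
    · rw [hag i he]
      exact (hσ _).2 hi he
    · exact (hstep _ hi).2 he _ (hπ i)
  have hD : ∀ i, π i ∈ D := by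
    intro i
    induction i with
    | zero => exact hπ0 ▸ ⟨x, hax⟩
    | succ i ih => exact (hPstep i ih).1
  rw [eveWinsPlay_iff]
  exact hasEvenLimit_of_measure (fun _ => hN _) (fun p t => truncate p (m (ξ (π t))))
    (fun p hp t ht => ((hPstep t (hD t)).2 p hp).1 ht)
    (fun p hp t ht => ((hPstep t (hD t)).2 p hp).2 ht)

/-- The positions that Eve's winning strategy can reach form a region with a progress measure. -/
theorem EveWinsFrom.exists_region {G : ParityGame.{u}} {x₀ : G.Pos} (h : G.EveWinsFrom x₀) :
    ∃ (W : Set G.Pos) (μ : ℕ → G.Pos → Ordinal.{u}), x₀ ∈ W ∧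
      (∀ x ∈ W, x ∈ G.eve → ∃ y ∈ W, G.edge x y ∧ Progress G.priority μ x y) ∧
      ∀ x ∈ W, x ∉ G.eve → ∀ y, G.edge x y → y ∈ W ∧ Progress G.priority μ x y := by
  obtain ⟨σ, hσ, hwin⟩ := h
  let R : G.Pos → G.Pos → Prop := fun x y => G.edge x y ∧ (x ∈ G.eve → y = σ x)
  let W : Set G.Pos := {x | ReflTransGen R x₀ x}
  have hW : ∀ x ∈ W, ∀ π : ℕ → G.Pos, (∀ i, R (π i) (π (i + 1))) → π 0 = x →
      G.EveWinsPlay π := by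
    intro x hx
    induction hx with
    | refl => exact fun π hπ h0 => hwin π (fun i => (hπ i).1) h0 fun i => (hπ i).2
    | @tail x y _ hxy ih =>
      intro π hπ h0
      -- The play is extended by its predecessor `x`; the winner does not depend on a finite prefix.
      refine (G.eveWinsPlay_succ (fun i => Nat.casesOn i x π)).2 (ih _ ?_ rfl)
      rintro (_ | i)
      · change R x (π 0)
        rwa [h0]
      · exact hπ i
  obtain ⟨μ, hμ⟩ := exists_progress (R := fun x y => x ∈ W ∧ R x y) (pr := G.priority)
    fun π hπ => (G.eveWinsPlay_iff π).1 (hW _ (hπ 0).1 π (fun i => (hπ i).2) rfl)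
  refine ⟨W, μ, .refl, fun x hx he => ?_, fun x hx he y hxy => ?_⟩
  · have hR : R x (σ x) := ⟨hσ x he, fun _ => rfl⟩
    exact ⟨σ x, ReflTransGen.tail hx hR, hR.1, hμ _ _ ⟨hx, hR⟩⟩
  · have hR : R x y := ⟨hxy, fun h => absurd h he⟩
    exact ⟨ReflTransGen.tail hx hR, hμ _ _ ⟨hx, hR⟩⟩

end ParityGame

/-! ## Acceptance of a graph and of its unfolding -/

namespace LabelledGraph

variable {α : Type u} (S : LabelledGraph.{u, w} α)

/-- The last vertex of a path. -/
def unfoldingHead (l : S.unfolding.V) : S.V := l.1.head l.2.ne_nil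

theorem unfolding_adj {S : LabelledGraph.{u, w} α} {l l' : S.unfolding.V}
    (h : S.unfolding.Adj l l') : S.Adj (S.unfoldingHead l) (S.unfoldingHead l') := by
  obtain ⟨l, hl⟩ := l
  obtain ⟨l', hl'⟩ := l'
  obtain ⟨y, hy⟩ := h
  change l' = y :: l at hy
  subst hy
  cases hl' with
  | root => exact absurd rfl hl.ne_nil
  | step h h' => exact h'

theorem exists_unfolding_adj {S : LabelledGraph.{u, w} α} (l : S.unfolding.V) {y : S.V}
    (h : S.Adj (S.unfoldingHead l) y) :
    ∃ l', S.unfolding.Adj l l' ∧ S.unfoldingHead l' = y := by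
  obtain ⟨l, hl⟩ := l
  cases l with
  | nil => exact absurd rfl hl.ne_nil
  | cons x l => exact ⟨⟨y :: x :: l, .step hl h⟩, ⟨y, rfl⟩, rfl⟩

end LabelledGraph

namespace APT

variable {α : Type u} (A : APT.{u, v} α)

theorem Move.of_unfolding {A : APT.{u, v} α} {S : LabelledGraph.{u, w} α}
    {a b : S.unfolding.V × (A.State ⊕ TransitionCondition A.State)}
    (h : A.Move S.unfolding a b) :
    A.Move S (S.unfoldingHead a.1, a.2) (S.unfoldingHead b.1, b.2) := by
  cases h with
  | state x q => exact .state _ _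
  | or_left x b b' => exact .or_left _ _ _
  | or_right x b b' => exact .or_right _ _ _
  | and_left x b b' => exact .and_left _ _ _
  | and_right x b b' => exact .and_right _ _ _
  | child x y m q h => exact .child _ _ _ _ (LabelledGraph.unfolding_adj h)

theorem Move.exists_unfolding {A : APT.{u, v} α} {S : LabelledGraph.{u, w} α}
    {l : S.unfolding.V} {c : A.State ⊕ TransitionCondition A.State}
    {b : S.V × (A.State ⊕ TransitionCondition A.State)}
    (h : A.Move S (S.unfoldingHead l, c) b) :
    ∃ l', S.unfoldingHead l' = b.1 ∧ A.Move S.unfolding (l, c) (l', b.2) := by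
  generalize ha : (S.unfoldingHead l, c) = a at h
  cases h with
  | state x q => cases ha; exact ⟨l, rfl, .state _ _⟩
  | or_left x b b' => cases ha; exact ⟨l, rfl, .or_left _ _ _⟩
  | or_right x b b' => cases ha; exact ⟨l, rfl, .or_right _ _ _⟩
  | and_left x b b' => cases ha; exact ⟨l, rfl, .and_left _ _ _⟩
  | and_right x b b' => cases ha; exact ⟨l, rfl, .and_right _ _ _⟩
  | child x y m q h =>
    cases ha
    obtain ⟨l', hl', rfl⟩ := LabelledGraph.exists_unfolding_adj l h
    exact ⟨l', rfl, .child _ _ _ _ hl'⟩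

/-- An automaton accepts the unfolding of a graph iff Eve wins the acceptance game that is played
on the graph itself. -/
theorem acceptsTree_unfolding (S : LabelledGraph.{u, w} α) :
    A.AcceptsTree S.unfolding ↔ A.AcceptsTree S := by
  constructor
  · intro h
    obtain ⟨W, μ, h₀, heve, hadam⟩ := ParityGame.EveWinsFrom.exists_region h
    -- A vertex of `S` has many nodes of the unfolding above it; these nodes are the memory of a
    -- strategy on `S`.
    refine (A.acceptanceGame S).eveWinsFrom_of_progress (X := W)
      (fun x => (S.unfoldingHead x.1.1, x.1.2)) (fun p x => μ p x) (fun x hx => ?_)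
      (fun x hx b hb => ?_) (x := ⟨_, h₀⟩) .refl
    · obtain ⟨y, hy, hxy, hpr⟩ := heve x x.2 hx
      exact ⟨_, ⟨y, hy⟩, hxy.of_unfolding, .refl, hpr⟩
    · obtain ⟨l', hl', hm⟩ := Move.exists_unfolding hb
      obtain ⟨hy, hpr⟩ := hadam x x.2 hx _ hm
      refine ⟨⟨_, hy⟩, ?_, hpr⟩
      simp only [hl']
      exact .refl
  · intro h
    obtain ⟨W, μ, h₀, heve, hadam⟩ := ParityGame.EveWinsFrom.exists_region h
    -- Conversely, region and measures are pulled back along the map to the last vertex.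
    refine (A.acceptanceGame S.unfolding).eveWinsFrom_of_progress
      (X := {x : S.unfolding.V × (A.State ⊕ TransitionCondition A.State) //
        (S.unfoldingHead x.1, x.2) ∈ W})
      (fun x => x.1) (fun p x => μ p (S.unfoldingHead x.1.1, x.1.2)) (fun x hx => ?_)
      (fun x hx b hb => ?_) (x := ⟨(S.unfolding.root, .inl A.init), h₀⟩) .refl
    · obtain ⟨⟨y, c⟩, hy, hxy, hpr⟩ := heve _ x.2 hx
      obtain ⟨l', rfl, hm⟩ := Move.exists_unfolding hxy
      exact ⟨_, ⟨(l', c), hy⟩, hm, .refl, hpr⟩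
    · obtain ⟨hy, hpr⟩ := hadam _ x.2 hx _ (Move.of_unfolding hb)
      exact ⟨⟨b, hy⟩, .refl, hpr⟩

/-! ## Paths through the acceptance game -/

/-- Every infinite path through an acceptance game visits states infinitely often. -/
theorem frequently_isLeft {A : APT.{u, v} α} {t : LabelledGraph.{u, w} α}
    {π : ℕ → t.V × (A.State ⊕ TransitionCondition A.State)}
    (hπ : ∀ i, A.Move t (π i) (π (i + 1))) : ∃ᶠ i in atTop, (π i).2.isLeft = true := by
  refine frequently_atTop.2 fun n => ?_
  have key : ∀ b n, (π n).2 = .inr b → ∃ i, n ≤ i ∧ (π i).2.isLeft = true := by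
    intro b
    induction b with
    | atom a =>
      intro n hn
      have h := hπ n
      generalize hy : π (n + 1) = y at h
      generalize hx : π n = x at h hn
      cases h <;> cases hn
      exact ⟨n + 1, n.le_succ, by rw [hy]; rfl⟩
    | and b b' ih ih' =>
      intro n hn
      have h := hπ n
      generalize hy : π (n + 1) = y at h
      generalize hx : π n = x at h hn
      cases h <;> cases hn
      · exact (ih (n + 1) (by rw [hy])).imp fun i hi => ⟨by omega, hi.2⟩
      · exact (ih' (n + 1) (by rw [hy])).imp fun i hi => ⟨by omega, hi.2⟩
    | or b b' ih ih' =>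
      intro n hn
      have h := hπ n
      generalize hy : π (n + 1) = y at h
      generalize hx : π n = x at h hn
      cases h <;> cases hn
      · exact (ih (n + 1) (by rw [hy])).imp fun i hi => ⟨by omega, hi.2⟩
      · exact (ih' (n + 1) (by rw [hy])).imp fun i hi => ⟨by omega, hi.2⟩
  rcases hc : (π n).2 with q | b
  · exact ⟨n, le_rfl, by rw [hc]; rfl⟩
  · exact key b n hc

/-! ## The acceptance game of the register version -/

/-- The transition condition `simulate b r o` after the choice of a register. -/
def simulateCore (k : ℕ) : TransitionCondition A.State → Registers k A.maxPriority →
    Fin (2 * k + 2) → TransitionCondition (A.RegState k)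
  | .atom (m, q), r, o => .atom (m, (q, r, o))
  | .and b b', r, o => .and (A.simulate k b r o) (A.simulate k b' r o)
  | .or b b', r, o => .or (A.simulate k b r o) (A.simulate k b' r o)

theorem simulate_eq (k : ℕ) (b : TransitionCondition A.State) (r : Registers k A.maxPriority)
    (o : Fin (2 * k + 2)) :
    A.simulate k b r o = PosBool.bigOr k fun i =>
      A.simulateCore k b (r.update i 0) (max o (r.output i 0)) := by
  rcases b with ⟨m, q⟩ | ⟨b, b'⟩ | ⟨b, b'⟩ <;> rfl

/-- Eve can choose any member of a disjunction. -/
theorem eveReach_bigOr (t : LabelledGraph.{u, w} α) (x : t.V) (k : ℕ)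
    (f : Fin (k + 1) → TransitionCondition A.State) (i : Fin (k + 1)) :
    (A.acceptanceGame t).EveReach (x, .inr (PosBool.bigOr k f)) (x, .inr (f i)) := by
  induction k with
  | zero =>
    obtain rfl : i = 0 := Fin.ext (by omega)
    exact .refl
  | succ k ih =>
    refine Fin.cases ?_ (fun j => ?_) i
    · exact .single ⟨trivial, rfl, .or_left _ _ _⟩
    · exact .head ⟨trivial, rfl, .or_right _ _ _⟩ (ih (fun i => f i.succ) j)

/-- In a region with a progress measure, Eve can leave a disjunction for one of its members without
increasing the measures. -/
theorem exists_mem_of_bigOr_mem {t : LabelledGraph.{u, w} α}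
    {W : Set (A.acceptanceGame t).Pos} {μ : ℕ → (A.acceptanceGame t).Pos → Ordinal.{max v w}}
    (heve : ∀ x ∈ W, x ∈ (A.acceptanceGame t).eve → ∃ y ∈ W, (A.acceptanceGame t).edge x y ∧
      Progress (A.acceptanceGame t).priority μ x y) (x : t.V) (k : ℕ)
    (f : Fin (k + 1) → TransitionCondition A.State) (h : (x, .inr (PosBool.bigOr k f)) ∈ W) :
    ∃ i, (x, .inr (f i)) ∈ W ∧
      ∀ p, Odd p → μ p (x, .inr (f i)) ≤ μ p (x, .inr (PosBool.bigOr k f)) := by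
  induction k with
  | zero => exact ⟨0, h, fun _ _ => le_rfl⟩
  | succ k ih =>
    obtain ⟨y, hy, hm, hpr⟩ := heve _ h trivial
    cases hm with
    | or_left => exact ⟨0, hy, fun p hp => (hpr p hp (Nat.zero_le _)).1⟩
    | or_right =>
      obtain ⟨i, hi, hi'⟩ := ih (fun i => f i.succ) hy
      exact ⟨i.succ, hi, fun p hp => (hi' p hp).trans (hpr p hp (Nat.zero_le _)).1⟩

/-- A position of the acceptance game of `A` with register contents and the largest output since
the previous state. -/
abbrev RegPos (k : ℕ) (t : LabelledGraph.{u, w} α) : Type (max v w) :=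
  (t.V × (A.State ⊕ TransitionCondition A.State)) × Registers k A.maxPriority × Fin (2 * k + 2)

variable {A} {k : ℕ} {t : LabelledGraph.{u, w} α}

/-- The priority of a position as a register content. -/
def posPriority : A.State ⊕ TransitionCondition A.State → Fin (A.maxPriority + 1)
  | .inl q => A.regPriority q
  | .inr _ => 0

theorem val_posPriority (c : A.State ⊕ TransitionCondition A.State) :
    (posPriority c).val = A.positionPriority c := by
  cases c <;> rfl

namespace RegPos

/-- The output when register `i` is chosen. -/
def out (x : A.RegPos k t) (i : Fin (k + 1)) : Fin (2 * k + 2) :=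
  x.2.1.output i (posPriority x.1.2)

/-- The position of the acceptance game of the register version at which the register for the
current position is about to be chosen. -/
def before : A.RegPos k t →
    t.V × ((A.registerVersion k).State ⊕ TransitionCondition (A.registerVersion k).State)
  | ((u, .inl q), r, o) => (u, .inl (q, r, o))
  | ((u, .inr b), r, o) => (u, .inr (A.simulate k b r o))

/-- The priority of the current position in the register version. -/
def regOutput (x : A.RegPos k t) : ℕ :=
  if x.1.2.isLeft = true then x.2.2.val else 0

/-- The register contents and outputs of `y` follow those of `x` if register `i` is chosen. -/
def Follows (i : Fin (k + 1)) (x y : A.RegPos k t) : Prop :=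
  y.2.1 = x.2.1.update i (posPriority x.1.2) ∧
    y.2.2 = if x.1.2.isLeft = true then x.out i else max x.2.2 (x.out i)

end RegPos

end APT

/-- Accumulating the outputs up to the next state does not change the limit. -/
theorem isLimitPriority_accumulate {s : ℕ → Prop} [DecidablePred s] {out o : ℕ → ℕ}
    (hs : ∃ᶠ i in atTop, s i) (ho : ∀ i, o (i + 1) = if s i then out i else max (o i) (out i))
    (p : ℕ) :
    IsLimitPriority (fun i => if s i then o i else 0) p ↔ IsLimitPriority out p := by
  -- Only positive thresholds need an argument: `0` is always attained, and it is also the value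
  -- reported outside `s`.
  have key : ∀ q, (∃ᶠ i in atTop, q + 1 ≤ if s i then o i else 0) ↔
      ∃ᶠ i in atTop, q + 1 ≤ out i := by
    intro q
    simp only [frequently_atTop]
    rw [frequently_atTop] at hs
    constructor
    · intro h n
      by_contra! hcon
      obtain ⟨i, hi, hsi⟩ := hs n
      obtain ⟨j, hj, hsj⟩ := h (i + 1)
      -- The reset at `i` forgets the earlier outputs, and all later ones are small.
      have hle : ∀ j, i + 1 ≤ j → o j < q + 1 := by
        intro j hj
        induction j, hj using Nat.le_induction with
        | base =>
          rw [ho, if_pos hsi]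
          exact hcon i hi
        | succ j hj ih =>
          rw [ho]
          have := hcon j (by omega)
          split_ifs
          · exact this
          · exact max_lt ih this
      have := hle j hj
      split_ifs at hsj <;> omega
    · intro h n
      obtain ⟨i, hi, hqi⟩ := h n
      by_contra! hcon
      -- A large output stays in the accumulator until the next member of `s`, which would report
      -- it; under `hcon` there could be no such member.
      have hle : ∀ j, i + 1 ≤ j → q + 1 ≤ o j ∧ (i + 1 < j → ¬ s (j - 1)) := by
        intro j hj
        induction j, hj using Nat.le_induction with
        | base =>
          refine ⟨?_, fun h => absurd h (lt_irrefl _)⟩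
          rw [ho]
          split_ifs
          · exact hqi
          · exact le_max_of_le_right hqi
        | succ j hj ih =>
          have hsj : ¬ s j := by
            intro hsj
            have := hcon j (by omega)
            rw [if_pos hsj] at this
            omega
          refine ⟨?_, fun _ => by simpa using hsj⟩
          rw [ho, if_neg hsj]
          exact le_max_of_le_left ih.1
      obtain ⟨j, hj, hsj⟩ := hs (i + 1)
      exact (hle (j + 1) (by omega)).2 (by omega) (by simpa using hsj)
  have hzero : ∀ a : ℕ → ℕ, ∃ᶠ i in atTop, 0 ≤ a i := fun a =>
    (Eventually.of_forall fun i => Nat.zero_le _).frequently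
  rw [isLimitPriority_iff_frequently_le, isLimitPriority_iff_frequently_le, key]
  cases p with
  | zero => simp only [hzero]
  | succ p => rw [key]

/-! ## Register updates along a sequence -/

namespace Registers

variable {k N : ℕ}

theorem update_self (r : Registers k N) (i : Fin (k + 1)) (p : Fin (N + 1)) :
    r.update i p i = p := by
  simp [update]

theorem update_of_lt (r : Registers k N) {i j : Fin (k + 1)} (p : Fin (N + 1)) (h : i < j) :
    r.update i p j = max (r j) p := by
  simp [update, h]

theorem val_output (r : Registers k N) (i : Fin (k + 1)) (p : Fin (N + 1)) :
    (r.output i p).val = if Even (max (r i).val p.val) then 2 * i.val else 2 * i.val + 1 := by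
  have : (max (r i) p : Fin (N + 1)).val = max (r i).val p.val := by
    rcases le_total (r i) p with h | h
    · rw [max_eq_right h, max_eq_right (Fin.le_def.1 h)]
    · rw [max_eq_left h, max_eq_left (Fin.le_def.1 h)]
  unfold output
  rw [this]
  split_ifs <;> rfl

/-- If register `I` is chosen at time `T` and no higher register is chosen from then on, its content
is the highest priority since its last choice. -/
theorem exists_last_choice {r : ℕ → Registers k N} {g : ℕ → Fin (k + 1)} {p : ℕ → Fin (N + 1)}
    (hr : ∀ t, r (t + 1) = (r t).update (g t) (p t)) {T : ℕ} {I : Fin (k + 1)} (hT : g T = I)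
    (hle : ∀ t, T ≤ t → g t ≤ I) {t : ℕ} (ht : T < t) :
    ∃ s, T ≤ s ∧ s < t ∧ g s = I ∧ (∀ j, s < j → j < t → g j ≠ I) ∧
      (∀ j, s ≤ j → j < t → p j ≤ r t I) ∧ ∃ j, s ≤ j ∧ j < t ∧ p j = r t I := by
  induction t, ht using Nat.le_induction with
  | base =>
    refine ⟨T, le_rfl, T.lt_succ_self, hT, fun j _ _ => by omega, fun j h1 h2 => ?_,
      T, le_rfl, T.lt_succ_self, ?_⟩
    · obtain rfl : j = T := by omega
      rw [hr, hT, update_self]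
    · rw [hr, hT, update_self]
  | succ t ht ih =>
    rcases (hle t (by omega)).eq_or_lt with heq | hlt
    · refine ⟨t, by omega, t.lt_succ_self, heq, fun j _ _ => by omega, fun j h1 h2 => ?_,
        t, le_rfl, t.lt_succ_self, ?_⟩
      · obtain rfl : j = t := by omega
        rw [hr, heq, update_self]
      · rw [hr, heq, update_self]
    · obtain ⟨s, h1, h2, h3, h4, h5, j, h6, h7, h8⟩ := ih
      have hup : r (t + 1) I = max (r t I) (p t) := by rw [hr, update_of_lt _ _ hlt]
      refine ⟨s, h1, by omega, h3, fun j hsj hj => ?_, fun j hsj hj => ?_, ?_⟩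
      · rcases Nat.lt_succ_iff_lt_or_eq.1 hj with hj | rfl
        · exact h4 j hsj hj
        · exact hlt.ne
      · rw [hup]
        rcases Nat.lt_succ_iff_lt_or_eq.1 hj with hj | rfl
        · exact le_max_of_le_left (h5 j hsj hj)
        · exact le_max_right _ _
      · rcases le_total (p t) (r t I) with h | h
        · exact ⟨j, h6, by omega, by rw [hup, max_eq_left h, h8]⟩
        · exact ⟨t, by omega, t.lt_succ_self, by rw [hup, max_eq_right h]⟩

/-- If the outputs have an even limit, so have the priorities. -/
theorem hasEvenLimit_of_output {r : ℕ → Registers k N} {g : ℕ → Fin (k + 1)}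
    {p : ℕ → Fin (N + 1)} (hr : ∀ t, r (t + 1) = (r t).update (g t) (p t))
    (h : HasEvenLimit fun t => ((r t).output (g t) (p t)).val) :
    HasEvenLimit fun t => (p t).val := by
  obtain ⟨_, ⟨hfreq, hev⟩, i, rfl⟩ := h
  obtain ⟨q, hq⟩ := exists_isLimitPriority (a := fun t => (p t).val) (N := N) fun t => by omega
  refine ⟨q, hq, ?_⟩
  simp only [val_output] at hfreq hev
  obtain ⟨T₀, hT₀⟩ := eventually_atTop.1 (hev.and hq.2)
  have hfreq' : ∀ n, ∃ t, n ≤ t ∧ (g t).val = i := by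
    intro n
    obtain ⟨t, ht, ht'⟩ := frequently_atTop.1 hfreq n
    refine ⟨t, ht, ?_⟩
    split_ifs at ht' <;> omega
  -- Eventually no output exceeds `2 i`; in particular register `i` does not output `2 i + 1`.
  have hout : ∀ t, T₀ ≤ t → (g t).val ≤ i ∧
      ((g t).val = i → Even (max (r t (g t)).val (p t).val)) := by
    intro t ht
    have := (hT₀ t ht).1
    split_ifs at this with h
    · exact ⟨by omega, fun _ => h⟩
    · exact ⟨by omega, fun _ => by omega⟩
  obtain ⟨T, hT, hTi⟩ := hfreq' T₀
  obtain ⟨m, hm, hmq⟩ := frequently_atTop.1 hq.1 (T + 1)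
  classical
  -- As `t` is the first choice of register `i` from time `m` on, the previous choice lies before
  -- `m`, and the maximum inspected at `t` includes the limit priority `q` seen at `m`.
  obtain ⟨t, ht, hgt, hfirst⟩ : ∃ t, m ≤ t ∧ (g t).val = i ∧ ∀ j, m ≤ j → j < t → (g j).val ≠ i := by
    have hex := hfreq' m
    exact ⟨Nat.find hex, (Nat.find_spec hex).1, (Nat.find_spec hex).2,
      fun j hj hlt hji => Nat.find_min hex hlt ⟨hj, hji⟩⟩
  have hgT : g t = g T := Fin.ext (by omega)
  obtain ⟨s, h1, h2, h3, h4, h5, j, h6, h7, h8⟩ := exists_last_choice hr (T := T) rfl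
    (fun t ht => Fin.le_def.2 (by have := (hout t (by omega)).1; omega)) (t := t) (by omega)
  have hsm : s < m := by
    by_contra! hms
    exact hfirst s hms h2 (by rw [h3, hTi])
  have heven := (hout t (by omega)).2 hgt
  rw [hgT] at heven
  have hle1 : (r t (g T)).val ≤ q := by
    rw [← h8]
    exact (hT₀ j (by omega)).2
  have hle2 : (p t).val ≤ q := (hT₀ t (by omega)).2
  have hge : q ≤ max (r t (g T)).val (p t).val := by
    rcases ht.eq_or_lt with rfl | hlt
    · exact le_max_of_le_right hmq.ge
    · refine le_max_of_le_left ?_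
      rw [← hmq]
      exact Fin.le_def.1 (h5 m hsm.le hlt)
  rwa [le_antisymm (max_le hle1 hle2) hge] at heven

end Registers

/-! ### From the register version to the automaton -/

namespace APT

variable {α : Type u} {A : APT.{u, v} α} {k : ℕ} {t : LabelledGraph.{u, w} α}

theorem RegPos.limit_regOutput {x : ℕ → A.RegPos k t} {g : ℕ → Fin (k + 1)}
    (hm : ∀ i, A.Move t (x i).1 (x (i + 1)).1) (hf : ∀ i, (x i).Follows (g i) (x (i + 1))) (p : ℕ) :
    IsLimitPriority (fun i => (x i).regOutput) p ↔
      IsLimitPriority (fun i => ((x i).out (g i)).val) p := by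
  refine isLimitPriority_accumulate (s := fun i => (x i).1.2.isLeft = true)
    (o := fun i => (x i).2.2.val) (frequently_isLeft hm) (fun i => ?_) p
  rw [(hf i).2]
  split_ifs
  · rfl
  · rcases le_total (x i).2.2 ((x i).out (g i)) with h | h
    · rw [max_eq_right h, max_eq_right (Fin.le_def.1 h)]
    · rw [max_eq_left h, max_eq_left (Fin.le_def.1 h)]

/-- Whatever the register version accepts is accepted by the automaton. -/
theorem acceptsTree_of_registerVersion (h : (A.registerVersion k).AcceptsTree t) :
    A.AcceptsTree t := by
  obtain ⟨W, μ, h₀, heve, hadam⟩ := ParityGame.EveWinsFrom.exists_region h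
  -- The winning region of the register game serves as a strategy for `A` whose memory is the
  -- register contents and the accumulated output.
  let X := {x : A.RegPos k t // x.before ∈ W}
  let ν : ℕ → X → Ordinal.{max v w} := fun p x => μ p x.1.before
  let kprog : X → X → Prop := Progress (fun x : X => x.1.regOutput) ν
  have hnext : ∀ x : X, ∃ i,
      ((A.IsEve x.1.1.2 → ∃ y : X, A.Move t x.1.1 y.1.1 ∧ x.1.Follows i y.1 ∧ kprog x y) ∧
      (¬ A.IsEve x.1.1.2 → ∀ b, A.Move t x.1.1 b →
        ∃ y : X, y.1.1 = b ∧ x.1.Follows i y.1 ∧ kprog x y)) := by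
    rintro ⟨⟨⟨u, q | b⟩, r, o⟩, hx⟩
    · obtain ⟨y, hy, hm, hpr⟩ := heve _ hx trivial
      cases hm
      obtain ⟨i, hi, hi'⟩ := exists_mem_of_bigOr_mem _ heve u k _ hy
      refine ⟨i, fun _ => ?_, fun h => absurd trivial h⟩
      refine ⟨⟨⟨(u, .inr (A.trans q (t.label u))), r.update i (A.regPriority q),
        r.output i (A.regPriority q)⟩, hi⟩, .state u q, ⟨rfl, rfl⟩, fun p hp hle => ?_⟩
      exact ⟨(hi' p hp).trans (hpr p hp hle).1, fun h => (hi' p hp).trans_lt ((hpr p hp hle).2 h)⟩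
    · have hx' : (u, .inr (A.simulate k b r o)) ∈ W := hx
      rw [simulate_eq] at hx'
      obtain ⟨i, hi, hi'⟩ := exists_mem_of_bigOr_mem _ heve u k _ hx'
      let next : t.V × (A.State ⊕ TransitionCondition A.State) → A.RegPos k t :=
        fun c => (c, r.update i 0, max o (r.output i 0))
      have hprog : ∀ c (hc : (next c).before ∈ W),
          Progress ((A.registerVersion k).acceptanceGame t).priority μ
            (u, .inr (A.simulateCore k b (r.update i 0) (max o (r.output i 0))))
            (next c).before → kprog ⟨⟨⟨u, .inr b⟩, r, o⟩, hx⟩ ⟨next c, hc⟩ := by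
        intro c hc hy p hp hle
        refine ⟨(hy p hp (Nat.zero_le _)).1.trans ?_, fun h => ?_⟩
        · refine (hi' p hp).trans (le_of_eq ?_)
          exact congrArg (fun c => μ p (u, .inr c)) (simulate_eq A k b r o).symm
        -- The output at a transition condition is `0`, which is not odd.
        · rw [← h] at hp
          exact absurd hp (by simp [RegPos.regOutput])
      refine ⟨i, fun he => ?_, fun he c hc => ?_⟩
      · rcases b with ⟨m, q⟩ | ⟨b, b'⟩ | ⟨b, b'⟩
        · cases m
          · obtain ⟨y, hy, hm, hpr⟩ := heve _ hi trivial
            cases hm with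
            | child _ y _ _ hadj =>
              exact ⟨⟨next (y, .inl q), hy⟩, .child _ _ _ _ hadj, ⟨rfl, rfl⟩, hprog (y, .inl q) hy hpr⟩
          · exact he.elim
        · exact he.elim
        · obtain ⟨y, hy, hm, hpr⟩ := heve _ hi trivial
          cases hm with
          | or_left =>
            exact ⟨⟨next (u, .inr b), hy⟩, .or_left _ _ _, ⟨rfl, rfl⟩, hprog (u, .inr b) hy hpr⟩
          | or_right =>
            exact ⟨⟨next (u, .inr b'), hy⟩, .or_right _ _ _, ⟨rfl, rfl⟩, hprog (u, .inr b') hy hpr⟩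
      · have hmem : (next c).before ∈ W ∧
            Progress ((A.registerVersion k).acceptanceGame t).priority μ
              (u, .inr (A.simulateCore k b (r.update i 0) (max o (r.output i 0))))
              (next c).before := by
          cases hc with
          | or_left => exact absurd trivial he
          | or_right => exact absurd trivial he
          | and_left b b' => exact hadam _ hi id _ (.and_left _ _ _)
          | and_right b b' => exact hadam _ hi id _ (.and_right _ _ _)
          | child _ y m q hadj =>
            cases m
            · exact absurd trivial he
            · exact hadam _ hi id _ (.child _ y _ _ hadj)
        exact ⟨⟨next c, hmem.1⟩, rfl, ⟨rfl, rfl⟩, hprog c hmem.1 hmem.2⟩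
  choose g heve' hadam' using hnext
  -- The measures `ν` control the outputs, hence the priorities of `A` along each infinite path;
  -- this yields new measures for these priorities.
  obtain ⟨μ', hμ'⟩ := exists_progress
    (R := fun x y : X => A.Move t x.1.1 y.1.1 ∧ x.1.Follows (g x) y.1 ∧ kprog x y)
    (pr := fun x => A.positionPriority x.1.1.2) (by
      intro π hπ
      obtain ⟨p, hp, he⟩ := hasEvenLimit_of_progress (N := 2 * k + 1)
        (fun x : X => by unfold RegPos.regOutput; split_ifs <;> omega) fun i => (hπ i).2.2
      rw [RegPos.limit_regOutput (x := fun i => (π i).1) (fun i => (hπ i).1)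
        (fun i => (hπ i).2.1)] at hp
      have := Registers.hasEvenLimit_of_output (r := fun i => (π i).1.2.1) (g := fun i => g (π i))
        (p := fun i => posPriority (π i).1.1.2) (fun i => (hπ i).2.1.1) ⟨p, hp, he⟩
      simpa only [val_posPriority] using this)
  refine (A.acceptanceGame t).eveWinsFrom_of_progress (X := X) (fun x => x.1.1) μ'
    (fun x hx => ?_) (fun x hx b hb => ?_)
    (x := ⟨⟨(t.root, .inl A.init), fun _ => 0, 0⟩, h₀⟩) .refl
  · obtain ⟨y, h1, h2, h3⟩ := heve' x hx
    exact ⟨_, y, h1, .refl, hμ' _ _ ⟨h1, h2, h3⟩⟩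
  · obtain ⟨y, rfl, h2, h3⟩ := hadam' x hx b hb
    exact ⟨y, .refl, hμ' _ _ ⟨hb, h2, h3⟩⟩

end APT

/-! ## Directed cycles and feedback vertex sets -/

theorem exists_walk_of_transGen {V : Type w} {E : V → V → Prop} {x y : V} (h : TransGen E x y) :
    ∃ (n : ℕ) (f : ℕ → V), f 0 = x ∧ f (n + 1) = y ∧ ∀ i ≤ n, E (f i) (f (i + 1)) := by
  induction h with
  | @single y h =>
    refine ⟨0, fun i => if i = 0 then x else y, rfl, rfl, fun i hi => ?_⟩
    obtain rfl : i = 0 := by omega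
    exact h
  | @tail b c _ h ih =>
    obtain ⟨n, f, h0, hn, hf⟩ := ih
    refine ⟨n + 1, fun i => if i ≤ n + 1 then f i else c, by simpa using h0, by simp,
      fun i hi => ?_⟩
    rcases hi.eq_or_lt with rfl | hlt
    · simpa [hn] using h
    · simpa [hi, Nat.lt_succ_iff.1 hlt] using hf i (by omega)

/-- A graph with a closed walk has a directed cycle. -/
theorem exists_isDirectedCycle {V : Type w} {E : V → V → Prop} {x : V} (h : TransGen E x x) :
    ∃ c, IsDirectedCycle E c ∧ ∀ y ∈ c, ∃ z, E y z := by
  classical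
  -- A shortest closed walk repeats no vertex, since a repetition would cut out a shorter one.
  have hex : ∃ n, ∃ f : ℕ → V, f (n + 1) = f 0 ∧ ∀ i ≤ n, E (f i) (f (i + 1)) := by
    obtain ⟨n, f, h0, hn, hf⟩ := exists_walk_of_transGen h
    exact ⟨n, f, by rw [h0, hn], hf⟩
  obtain ⟨f, hclosed, hf⟩ := Nat.find_spec hex
  have hmin : ∀ m < Nat.find hex, _ := fun m => Nat.find_min hex (m := m)
  generalize Nat.find hex = n at hclosed hf hmin
  have hne : ∀ i j, i < j → j ≤ n → f i ≠ f j := by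
    intro i j hij hj heq
    refine hmin (j - i - 1) (by omega) ⟨fun l => f (i + l), ?_, fun l hl => hf (i + l) (by omega)⟩
    change f (i + (j - i - 1 + 1)) = f (i + 0)
    rw [show i + (j - i - 1 + 1) = j by omega, ← heq, add_zero]
  refine ⟨((List.range (n + 1) : Cycle ℕ).map f), ⟨?_, ?_, ?_⟩, ?_⟩
  · rw [Cycle.map_coe, Ne, Cycle.coe_eq_nil]
    simp
  · rw [Cycle.map_coe, Cycle.nodup_coe_iff]
    refine List.Nodup.map_on (fun i hi j hj heq => ?_) List.nodup_range
    rw [List.mem_range] at hi hj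
    rcases lt_trichotomy i j with h | h | h
    · exact absurd heq (hne i j h (by omega))
    · exact h
    · exact absurd heq.symm (hne j i h (by omega))
  · rw [Cycle.chain_map, Cycle.chain_range_succ]
    exact ⟨hclosed ▸ hf n le_rfl, fun m hm => hf m hm.le⟩
  · intro y hy
    rw [Cycle.map_coe, Cycle.mem_coe_iff, List.mem_map] at hy
    obtain ⟨i, hi, rfl⟩ := hy
    rw [List.mem_range] at hi
    exact ⟨_, hf i (by omega)⟩

namespace LabelledGraph

variable {α : Type u} {S : LabelledGraph.{u, w} α}

theorem scc_eq_of_mem {x y : S.V} (h : y ∈ S.scc x) : S.scc y = S.scc x := by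
  ext z
  exact ⟨fun hz => ⟨h.1.trans hz.1, hz.2.trans h.2⟩, fun hz => ⟨h.2.trans hz.1, hz.2.trans h.1⟩⟩

/-- In a finite graph, the minimum feedback vertex sets of the strongly connected components can be
put together. -/
theorem SCCsHaveFvsSizeAtMost.exists_set [Finite S.V] {d : ℕ} (h : S.SCCsHaveFvsSizeAtMost d) :
    ∃ F : Set S.V, (∀ x, (F ∩ S.scc x).ncard ≤ d) ∧ ∀ x (c : Cycle (S.scc x)),
      IsDirectedCycle (fun a b : S.scc x => S.Adj a b) c → ∃ y ∈ c, y.1 ∈ F := by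
  classical
  -- Indexing by the component instead of a vertex gives all its vertices the same feedback set.
  have hF : ∀ C : Set S.V, ∃ F : Finset S.V, ∀ x, S.scc x = C → F.card ≤ d ∧
      ∀ c : Cycle (S.scc x), IsDirectedCycle (fun a b : S.scc x => S.Adj a b) c →
        ∃ y ∈ c, y.1 ∈ F := by
    intro C
    by_cases hC : ∃ x, S.scc x = C
    · obtain ⟨x, rfl⟩ := hC
      -- The whole component is a finite feedback vertex set, so the infimum in `fvsSize` is
      -- attained and is not the default value `0` of an empty set.
      have hne : {m | ∃ F : Finset (S.scc x), F.card = m ∧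
          IsFeedbackVertexSet (fun a b : S.scc x => S.Adj a b) (F : Set (S.scc x))}.Nonempty := by
        have := Fintype.ofFinite (S.scc x)
        refine ⟨_, Finset.univ, rfl, fun c hc => ?_⟩
        obtain ⟨y, hy⟩ : ∃ y, y ∈ c := by
          induction c using Cycle.induction_on with
          | nil => exact absurd rfl hc.1
          | cons a l => exact ⟨a, by simp⟩
        exact ⟨y, hy, by simp⟩
      obtain ⟨F, hFc, hF⟩ := Nat.sInf_mem hne
      refine ⟨F.map (Function.Embedding.subtype _), fun y hy => ?_⟩
      have key : ∀ C, C = S.scc x → ∀ c : Cycle C,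
          IsDirectedCycle (fun a b : C => S.Adj a b) c →
          ∃ y ∈ c, y.1 ∈ F.map (Function.Embedding.subtype _) := by
        rintro C rfl c hc
        obtain ⟨y, hy, hyF⟩ := hF c hc
        exact ⟨y, hy, Finset.mem_map.2 ⟨y, hyF, rfl⟩⟩
      exact ⟨by rw [Finset.card_map, hFc]; exact h x, key _ hy⟩
    · exact ⟨∅, fun x hx => absurd ⟨x, hx⟩ hC⟩
  choose F hF using hF
  refine ⟨{y | y ∈ F (S.scc y)}, fun x => ?_, fun x c hc => ?_⟩
  · refine le_trans ?_ (hF _ x rfl).1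
    rw [← Set.ncard_coe_finset]
    refine Set.ncard_le_ncard ?_ (Finset.finite_toSet _)
    rintro y ⟨hy, hyx⟩
    rw [← scc_eq_of_mem hyx]
    exact hy
  · obtain ⟨y, hy, hyF⟩ := (hF _ x rfl).2 c hc
    refine ⟨y, hy, ?_⟩
    change y.1 ∈ F (S.scc y.1)
    rwa [scc_eq_of_mem y.2]

end LabelledGraph

namespace APT

variable {α : Type u} {A : APT.{u, v} α} {S : LabelledGraph.{u, w} α}

theorem Move.reflTransGen_adj {a b : S.V × (A.State ⊕ TransitionCondition A.State)}
    (h : A.Move S a b) : ReflTransGen S.Adj a.1 b.1 := by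
  cases h with
  | child _ _ _ _ h => exact .single h
  | _ => exact .refl

/-- A closed walk through the acceptance game visits a state at a vertex of any set that meets the
cycles of all strongly connected components. -/
theorem exists_feedback_mem {F : Set S.V}
    (hF : ∀ x (c : Cycle (S.scc x)), IsDirectedCycle (fun a b : S.scc x => S.Adj a b) c →
      ∃ y ∈ c, y.1 ∈ F)
    {r : S.V × (A.State ⊕ TransitionCondition A.State) →
      S.V × (A.State ⊕ TransitionCondition A.State) → Prop}
    (hr : ∀ a b, r a b → A.Move S a b) {u : S.V} {q : A.State}
    (h : TransGen r (u, .inl q) (u, .inl q)) :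
    ∃ v q', v ∈ F ∧ TransGen r (u, .inl q) (v, .inl q') ∧
      TransGen r (v, .inl q') (u, .inl q) := by
  by_contra! hcon
  have hproj : ∀ a b, TransGen r a b → ReflTransGen S.Adj a.1 b.1 := by
    intro a b hab
    induction hab with
    | single h => exact (hr _ _ h).reflTransGen_adj
    | tail _ h ih => exact ih.trans (hr _ _ h).reflTransGen_adj
  have hscc : ∀ y, TransGen r (u, .inl q) y → TransGen r y (u, .inl q) → y.1 ∈ S.scc u :=
    fun y h1 h2 => ⟨hproj _ _ h1, hproj _ _ h2⟩
  -- If no state on the walk lies over `F`, the walk projects to a closed walk in the component that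
  -- avoids `F`; it contains a cycle that `F` misses.
  let E : S.scc u → S.scc u → Prop := fun a b => S.Adj a b ∧ a.1 ∉ F ∧ b.1 ∉ F
  have hu : u ∉ F := fun hu => hcon u q hu h h
  let o : S.scc u := ⟨u, .refl, .refl⟩
  have hwalk : ∀ y, TransGen r (u, .inl q) y → TransGen r y (u, .inl q) →
      y.1 ∉ F ∧ ∀ hy : y.1 ∈ S.scc u, ReflTransGen E o ⟨y.1, hy⟩ := by
    intro y hy
    induction hy with
    | @single y hy =>
      intro _
      have := hr _ _ hy
      cases this
      exact ⟨hu, fun _ => .refl⟩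
    | @tail b c hb hbc ih =>
      intro hc
      have hb' : TransGen r b (u, .inl q) := .head hbc hc
      obtain ⟨hbF, hob⟩ := ih hb'
      have hm := hr _ _ hbc
      cases hm with
      | child x y m q' hadj =>
        have hyF : y ∉ F := fun hyF => hcon y q' hyF (hb.tail hbc) hc
        exact ⟨hyF, fun hy => (hob (hscc _ hb hb')).tail ⟨hadj, hbF, hyF⟩⟩
      | _ => exact ⟨hbF, hob⟩
  have hclosed : TransGen E o o := by
    obtain ⟨b, hb, hm⟩ := TransGen.tail'_iff.1 h
    have hm' := hr _ _ hm
    rcases hb.cases_tail with heq | ⟨b', hb', hbb⟩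
    · rw [← heq] at hm'
      cases hm'
    · have h1 : TransGen r (u, .inl q) b := .tail' hb' hbb
      have h2 := hwalk b h1 (.single hm)
      have h3 := hscc b h1 (.single hm)
      have hadj : S.Adj b.1 u := by
        cases hm'
        assumption
      exact .tail' (h2.2 h3) ⟨hadj, h2.1, hu⟩
  obtain ⟨c, hc, hout⟩ := exists_isDirectedCycle hclosed
  obtain ⟨y, hy, hyF⟩ := hF u c ⟨hc.1, hc.2.1, hc.2.2.imp fun _ _ h => h.1⟩
  obtain ⟨z, hz⟩ := hout y hy
  exact hz.2.1 hyF

end APT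

/-! ## Choosing registers by the size of components -/

/-- The edges between vertices of priority at most `p`. -/
def EdgeBelow {V : Type w} (H : V → V → Prop) (pr : V → ℕ) (p : ℕ) (a b : V) : Prop :=
  H a b ∧ pr a ≤ p ∧ pr b ≤ p

/-- The strongly connected component of `v` among the vertices of priority at most that of `v`;
it is empty if `v` does not lie on a cycle of such vertices. -/
def componentBelow {V : Type w} (H : V → V → Prop) (pr : V → ℕ) (v : V) : Set V :=
  {x | TransGen (EdgeBelow H pr (pr v)) v x ∧ TransGen (EdgeBelow H pr (pr v)) x v}

section Components

variable {V : Type w} {H : V → V → Prop} {pr : V → ℕ}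

theorem EdgeBelow.transGen_mono {p q : ℕ} (hpq : p ≤ q) {a b : V}
    (h : TransGen (EdgeBelow H pr p) a b) : TransGen (EdgeBelow H pr q) a b :=
  TransGen.mono (fun _ _ h => ⟨h.1, h.2.1.trans hpq, h.2.2.trans hpq⟩) _ _ h

/-- This nesting makes the chosen register monotone in the component. -/
theorem componentBelow_subset {v x : V} (hx : x ∈ componentBelow H pr v) (hle : pr x ≤ pr v) :
    componentBelow H pr x ⊆ componentBelow H pr v := fun _ hy =>
  ⟨hx.1.trans (EdgeBelow.transGen_mono hle hy.1), (EdgeBelow.transGen_mono hle hy.2).trans hx.2⟩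

theorem measure_le_of_transGen {μ : ℕ → V → Ordinal.{v}}
    (hμ : ∀ a b, H a b → Progress pr μ a b) {p : ℕ} (hp : Odd p) {a b : V}
    (h : TransGen (EdgeBelow H pr p) a b) : μ p b ≤ μ p a ∧ (pr a = p → μ p b < μ p a) := by
  induction h with
  | single h => exact hμ _ _ h.1 p hp h.2.1
  | tail _ h ih =>
    have := (hμ _ _ h.1 p hp h.2.1).1
    exact ⟨this.trans ih.1, fun ha => this.trans_lt (ih.2 ha)⟩

/-- If the top priority of a closed walk were odd, its measure would be smaller than itself. -/
theorem even_of_transGen_self {μ : ℕ → V → Ordinal.{v}}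
    (hμ : ∀ a b, H a b → Progress pr μ a b) {a : V}
    (h : TransGen (EdgeBelow H pr (pr a)) a a) : Even (pr a) := by
  by_contra hodd
  rw [Nat.not_even_iff_odd] at hodd
  exact lt_irrefl _ ((measure_le_of_transGen hμ hodd h).2 rfl)

theorem transGen_of_path {π : ℕ → V} (hπ : ∀ i, H (π i) (π (i + 1))) {p i j : ℕ} (hij : i < j)
    (hp : ∀ l, i ≤ l → l ≤ j → pr (π l) ≤ p) : TransGen (EdgeBelow H pr p) (π i) (π j) := by
  induction j, hij using Nat.le_induction with
  | base => exact .single ⟨hπ i, hp _ le_rfl i.le_succ, hp _ i.le_succ le_rfl⟩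
  | succ j hij ih =>
    exact (ih fun l h1 h2 => hp l h1 (by omega)).tail
      ⟨hπ j, hp _ (by omega) j.le_succ, hp _ (by omega) le_rfl⟩

/-- The choice of registers by the binary length of the number of feedback vertices in components
yields an even limit output. -/
theorem hasEvenLimit_output_of_size {k N : ℕ} {μ : ℕ → V → Ordinal.{v}}
    (hμ : ∀ a b, H a b → Progress pr μ a b) {F : Set V}
    (hfin : ∀ v, (F ∩ componentBelow H pr v).Finite) {g : V → Fin (k + 1)}
    (hg : ∀ v, (g v).val = Nat.size (F ∩ componentBelow H pr v).ncard)
    {π : ℕ → V} (hπ : ∀ i, H (π i) (π (i + 1))) {x₀ : V} (hx₀ : ∃ᶠ i in atTop, π i = x₀)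
    (hmax : ∀ᶠ i in atTop, pr (π i) ≤ pr x₀) (hne : (F ∩ componentBelow H pr x₀).Nonempty)
    {r : ℕ → Registers k N} {p : ℕ → Fin (N + 1)} (hp : ∀ i, (p i).val = pr (π i))
    (hr : ∀ i, r (i + 1) = (r i).update (g (π i)) (p i)) :
    HasEvenLimit fun i => ((r i).output (g (π i)) (p i)).val := by
  obtain ⟨T₀, hT₀⟩ := eventually_atTop.1 hmax
  obtain ⟨T, hT, hTx⟩ := frequently_atTop.1 hx₀ T₀
  have hle : ∀ t, T ≤ t → pr (π t) ≤ pr x₀ := fun t ht => hT₀ t (hT.trans ht)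
  have hreach : ∀ t, T ≤ t → TransGen (EdgeBelow H pr (pr x₀)) (π t) x₀ := by
    intro t ht
    obtain ⟨s, hs, hsx⟩ := frequently_atTop.1 hx₀ (t + 1)
    rw [← hsx]
    exact transGen_of_path hπ hs fun l h1 _ => hsx.symm ▸ hle l (ht.trans h1)
  have hmem : ∀ t, T ≤ t → π t ∈ componentBelow H pr x₀ := by
    intro t ht
    refine ⟨?_, hreach t ht⟩
    rcases ht.eq_or_lt with rfl | hlt
    · rw [hTx]
      exact hTx ▸ hreach T le_rfl
    · have h := transGen_of_path hπ hlt fun l h1 _ => hle l h1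
      rwa [hTx] at h
  have hsub : ∀ t, T ≤ t → componentBelow H pr (π t) ⊆ componentBelow H pr x₀ := fun t ht =>
    componentBelow_subset (hmem t ht) (hle t ht)
  have hgle : ∀ t, T ≤ t → g (π t) ≤ g x₀ := by
    intro t ht
    rw [Fin.le_def, hg, hg]
    exact Nat.size_le_size (Set.ncard_le_ncard
      (Set.inter_subset_inter_right _ (hsub t ht)) (hfin _))
  have hpos : 0 < (g x₀).val := by
    rw [hg, Nat.size_pos]
    exact (Set.ncard_pos (hfin _)).2 hne
  -- two components for the highest register cannot be disjoint
  have hmeet : ∀ s t, T ≤ s → T ≤ t → g (π s) = g x₀ → g (π t) = g x₀ →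
      (componentBelow H pr (π s) ∩ componentBelow H pr (π t)).Nonempty := by
    intro s t hs ht hgs hgt
    by_contra hemp
    rw [Set.not_nonempty_iff_eq_empty, ← Set.disjoint_iff_inter_eq_empty] at hemp
    -- A number of bit length `I > 0` is at least `2 ^ (I - 1)`; two disjoint components would give
    -- `2 ^ I` feedback positions, and bit length above `I`, in the component of `x₀`.
    have hbig : ∀ v, g v = g x₀ →
        2 ^ ((g x₀).val - 1) ≤ (F ∩ componentBelow H pr v).ncard := by
      intro v hv
      rw [← Nat.lt_size, ← hg, hv]
      omega
    have hunion : (F ∩ componentBelow H pr (π s)).ncard + (F ∩ componentBelow H pr (π t)).ncard ≤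
        (F ∩ componentBelow H pr x₀).ncard := by
      rw [← Set.ncard_union_eq (hemp.mono Set.inter_subset_right Set.inter_subset_right)
        (hfin _) (hfin _)]
      exact Set.ncard_le_ncard (Set.union_subset (Set.inter_subset_inter_right _ (hsub s hs))
        (Set.inter_subset_inter_right _ (hsub t ht))) (hfin _)
    have h1 := hbig _ hgs
    have h2 := hbig _ hgt
    have h3 : 2 ^ (g x₀).val = 2 ^ ((g x₀).val - 1) + 2 ^ ((g x₀).val - 1) := by
      rw [← two_mul, ← pow_succ', Nat.sub_add_cancel hpos]
    have h4 : (g x₀).val < Nat.size (F ∩ componentBelow H pr x₀).ncard := by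
      rw [Nat.lt_size]
      omega
    rw [← hg] at h4
    exact lt_irrefl _ h4
  have heven : ∀ s t m, T ≤ s → s ≤ m → m ≤ t → g (π s) = g x₀ → g (π t) = g x₀ →
      (∀ j, s ≤ j → j ≤ t → pr (π j) ≤ pr (π m)) → Even (pr (π m)) := by
    intro s t m hs hsm hmt hgs hgt hm
    obtain ⟨y, hys, hyt⟩ := hmeet s t hs (by omega) hgs hgt
    -- The common vertex `y` leads back from the end of the segment to its start within priorities
    -- at most that of `π m`, so `π m` is a maximum on a closed walk.
    have hback : TransGen (EdgeBelow H pr (pr (π m))) (π t) (π s) :=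
      (EdgeBelow.transGen_mono (hm t (by omega) le_rfl) hyt.1).trans
        (EdgeBelow.transGen_mono (hm s le_rfl (by omega)) hys.2)
    have hseg : ∀ i j, s ≤ i → i ≤ j → j ≤ t →
        ReflTransGen (EdgeBelow H pr (pr (π m))) (π i) (π j) := by
      intro i j hi hij hj
      rcases hij.eq_or_lt with rfl | hlt
      · exact .refl
      · exact (transGen_of_path hπ hlt fun l h1 h2 => hm l (by omega) (by omega)).to_reflTransGen
    exact even_of_transGen_self hμ
      (TransGen.trans_left (TransGen.trans_right (hseg m t hsm hmt le_rfl) hback)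
        (hseg s m le_rfl hsm hmt))
  have hout : ∀ t, T < t → g (π t) = g x₀ →
      ((r t).output (g (π t)) (p t)).val = 2 * (g x₀).val := by
    intro t ht hgt
    obtain ⟨s, h1, h2, h3, -, h5, j, h6, h7, h8⟩ := Registers.exists_last_choice hr (T := T)
      (I := g x₀) (by rw [hTx]) hgle ht
    rw [Registers.val_output, hgt, if_pos]
    have h5' : ∀ l, s ≤ l → l < t → pr (π l) ≤ (r t (g x₀)).val := by
      intro l hl hl'
      rw [← hp]
      exact h5 l hl hl'
    have h8' : pr (π j) = (r t (g x₀)).val := by rw [← hp, h8]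
    rw [hp]
    rcases le_total (r t (g x₀)).val (pr (π t)) with hle' | hle'
    · rw [max_eq_right hle']
      refine heven s t t h1 h2.le le_rfl h3 hgt fun l hl hl' => ?_
      rcases hl'.eq_or_lt with rfl | hlt
      · exact le_rfl
      · exact (h5' l hl hlt).trans hle'
    · rw [max_eq_left hle', ← h8']
      refine heven s t j h1 h6 h7.le h3 hgt fun l hl hl' => ?_
      rw [h8']
      rcases hl'.eq_or_lt with rfl | hlt
      · exact hle'
      · exact h5' l hl hlt
  refine ⟨2 * (g x₀).val, ⟨frequently_atTop.2 fun n => ?_, ?_⟩, even_two_mul _⟩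
  · obtain ⟨t, ht, htx⟩ := frequently_atTop.1 hx₀ (max n (T + 1))
    have := le_max_left n (T + 1)
    have := le_max_right n (T + 1)
    exact ⟨t, by omega, hout t (by omega) (by rw [htx])⟩
  · filter_upwards [eventually_gt_atTop T] with t ht
    rcases (hgle t ht.le).eq_or_lt with heq | hlt
    · exact (hout t ht heq).le
    · rw [Registers.val_output]
      have := Fin.lt_def.1 hlt
      split_ifs <;> omega

end Components

/-! ### From the automaton to the register version -/

namespace APT

variable {α : Type u} {A : APT.{u, v} α} {k : ℕ}

/-- On a finite graph, every infinite path through the acceptance game visits infinitely often a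
state whose priority is not exceeded from some point on. -/
theorem exists_frequent_state [Finite A.State] {S : LabelledGraph.{u, w} α} [Finite S.V]
    {π : ℕ → S.V × (A.State ⊕ TransitionCondition A.State)}
    (hπ : ∀ i, A.Move S (π i) (π (i + 1))) :
    ∃ u q, (∃ᶠ i in atTop, π i = (u, .inl q)) ∧
      ∀ᶠ i in atTop, A.positionPriority (π i).2 ≤ A.priority q := by
  obtain ⟨p, hp⟩ := exists_isLimitPriority (a := fun i => A.positionPriority (π i).2)
    (N := A.maxPriority) fun i => by
      rcases (π i).2 with q | b
      · exact A.le_maxPriority q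
      · exact Nat.zero_le _
  have hst : ∃ᶠ i in atTop, ∃ x : S.V × A.State, π i = (x.1, .inl x.2) ∧ A.priority x.2 = p := by
    have hleft : ∃ᶠ i in atTop, (π i).2.isLeft = true ∧ A.positionPriority (π i).2 = p := by
      -- Positive priorities occur only at states. Transition conditions also have priority `0`, so
      -- for `p = 0` the recurrence of states is needed.
      rcases Nat.eq_zero_or_pos p with rfl | hpos
      · exact ((frequently_isLeft hπ).and_eventually hp.2).mono fun i hi =>
          ⟨hi.1, Nat.le_zero.1 hi.2⟩
      · refine hp.1.mono fun i hi => ⟨?_, hi⟩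
        rcases hc : (π i).2 with q | b
        · rfl
        · simp only [hc] at hi
          exact absurd hi hpos.ne
    refine hleft.mono fun i hi => ?_
    rcases hc : π i with ⟨u, q | b⟩
    · rw [hc] at hi
      exact ⟨(u, q), rfl, hi.2⟩
    · rw [hc] at hi
      exact absurd hi.1 (by simp)
  have : ∃ x : S.V × A.State, ∃ᶠ i in atTop, π i = (x.1, .inl x.2) ∧ A.priority x.2 = p := by
    by_contra hcon
    simp only [not_exists, not_frequently] at hcon
    exact hst ((eventually_all.2 hcon).mono fun i hi => not_exists.2 hi)
  obtain ⟨⟨u, q⟩, hx⟩ := this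
  obtain ⟨_, _, hq⟩ := hx.exists
  exact ⟨u, q, hx.mono fun i hi => hi.1, hp.2.mono fun i hi => hi.trans hq.ge⟩

namespace RegPos

/-- The position of the acceptance game of the register version that `x` stands for: before the
choice of a register at a state, and after the choice of register `i` at a transition condition. -/
def after {t : LabelledGraph.{u, w} α} (i : Fin (k + 1)) : A.RegPos k t →
    t.V × ((A.registerVersion k).State ⊕ TransitionCondition (A.registerVersion k).State)
  | ((u, .inl q), r, o) => (u, .inl (q, r, o))
  | ((u, .inr b), r, o) =>
      (u, .inr (A.simulateCore k b (r.update i 0) (max o (r.output i 0))))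

/-- The nodes of the disjunction over registers are Eve's and have priority `0`, so they need no
measure of their own. -/
theorem eveReach_after {t : LabelledGraph.{u, w} α} (i : Fin (k + 1)) (x : A.RegPos k t) :
    ((A.registerVersion k).acceptanceGame t).EveReach x.before (x.after i) := by
  obtain ⟨⟨u, q | b⟩, r, o⟩ := x
  · exact .refl
  · have h := (A.registerVersion k).eveReach_bigOr t u k
      (fun i => A.simulateCore k b (r.update i 0) (max o (r.output i 0))) i
    have h' : (u, .inr (PosBool.bigOr k fun i =>
        A.simulateCore k b (r.update i 0) (max o (r.output i 0)))) =
        before (A := A) (t := t) ((u, .inr b), r, o) :=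
      congrArg (fun c => (u, Sum.inr c)) (simulate_eq A k b r o).symm
    rwa [← h']

/-- The successor of `x` at the position `c` if register `i` is chosen. -/
def next {t : LabelledGraph.{u, w} α} (i : Fin (k + 1)) (x : A.RegPos k t)
    (c : t.V × (A.State ⊕ TransitionCondition A.State)) : A.RegPos k t :=
  (c, x.2.1.update i (posPriority x.1.2),
    if x.1.2.isLeft = true then x.out i else max x.2.2 (x.out i))

end RegPos

/-- If all strongly connected components of a finite graph have small feedback vertex sets, the
register version accepts the graph whenever the automaton does. -/
theorem registerVersion_acceptsTree {S : LabelledGraph.{u, w} α} [Finite S.V] {d : ℕ}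
    (hS : S.SCCsHaveFvsSizeAtMost d) (hk : d * A.numStates < 2 ^ k) (h : A.AcceptsTree S) :
    (A.registerVersion k).AcceptsTree S := by
  have := A.finite
  obtain ⟨F, hFcard, hF⟩ := hS.exists_set
  obtain ⟨W, μ, h₀, heve, hadam⟩ := ParityGame.EveWinsFrom.exists_region h
  let pr : S.V × (A.State ⊕ TransitionCondition A.State) → ℕ := fun x => A.positionPriority x.2
  let H : S.V × (A.State ⊕ TransitionCondition A.State) →
      S.V × (A.State ⊕ TransitionCondition A.State) → Prop :=
    fun x y => A.Move S x y ∧ y ∈ W ∧ Progress pr μ x y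
  -- Counting only states, and no transition conditions, gives the factor `n` in the bound.
  let F' : Set (S.V × (A.State ⊕ TransitionCondition A.State)) :=
    (fun x : S.V × A.State => (x.1, .inl x.2)) '' (F ×ˢ Set.univ)
  have hfin : ∀ v, (F' ∩ componentBelow H pr v).Finite := fun v =>
    ((Set.toFinite _).image _).subset Set.inter_subset_left
  have hcard : ∀ v, (F' ∩ componentBelow H pr v).ncard ≤ d * A.numStates := by
    intro v
    have hproj : ∀ {p a b}, TransGen (EdgeBelow H pr p) a b → ReflTransGen S.Adj a.1 b.1 := by
      intro p a b hab
      induction hab with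
      | single h => exact h.1.1.reflTransGen_adj
      | tail _ h ih => exact ih.trans h.1.1.reflTransGen_adj
    have hsub : F' ∩ componentBelow H pr v ⊆
        (fun x : S.V × A.State => (x.1, .inl x.2)) '' ((F ∩ S.scc v.1) ×ˢ Set.univ) := by
      rintro _ ⟨⟨x, hx, rfl⟩, hv⟩
      exact ⟨x, ⟨⟨hx.1, hproj hv.1, hproj hv.2⟩, trivial⟩, rfl⟩
    calc (F' ∩ componentBelow H pr v).ncard
        ≤ ((F ∩ S.scc v.1) ×ˢ (Set.univ : Set A.State)).ncard :=
          (Set.ncard_le_ncard hsub ((Set.toFinite _).image _)).trans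
            (Set.ncard_image_le (Set.toFinite _))
      _ = (F ∩ S.scc v.1).ncard * A.numStates := by
          rw [Set.ncard_prod, Set.ncard_univ]
          rfl
      _ ≤ d * A.numStates := Nat.mul_le_mul_right _ (hFcard _)
  let g : S.V × (A.State ⊕ TransitionCondition A.State) → Fin (k + 1) := fun v =>
    ⟨Nat.size (F' ∩ componentBelow H pr v).ncard,
      Nat.lt_succ_of_le (Nat.size_le.2 ((hcard v).trans_lt hk))⟩
  let X := {x : A.RegPos k S // x.1 ∈ W}
  have hpath : ∀ π : ℕ → X,
      (∀ i, H (π i).1.1 (π (i + 1)).1.1 ∧ (π i).1.Follows (g (π i).1.1) (π (i + 1)).1) →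
      HasEvenLimit fun i => (π i).1.regOutput := by
    intro π hπ
    have hH : ∀ i, H (π i).1.1 (π (i + 1)).1.1 := fun i => (hπ i).1
    obtain ⟨u, q, hfreq, hmax⟩ := exists_frequent_state (π := fun i => (π i).1.1)
      fun i => (hH i).1
    -- Two late visits bound a closed walk, which passes a feedback position; hence the component of
    -- the recurrent state has positive count.
    have hself : TransGen (EdgeBelow H pr (A.priority q)) (u, .inl q) (u, .inl q) := by
      obtain ⟨T, hT⟩ := eventually_atTop.1 hmax
      obtain ⟨i, hi, hi'⟩ := frequently_atTop.1 hfreq T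
      obtain ⟨j, hj, hj'⟩ := frequently_atTop.1 hfreq (i + 1)
      have := transGen_of_path (pr := pr) hH hj (p := A.priority q) fun l h1 _ =>
        hT l (hi.trans h1)
      rwa [hi', hj'] at this
    have hne : (F' ∩ componentBelow H pr (u, .inl q)).Nonempty := by
      obtain ⟨v, q', hv, h1, h2⟩ := exists_feedback_mem hF (fun a b h => h.1.1) hself
      exact ⟨(v, .inl q'), ⟨(v, q'), ⟨hv, trivial⟩, rfl⟩, h1, h2⟩
    obtain ⟨p, hp, he⟩ := hasEvenLimit_output_of_size (H := H) (pr := pr) (μ := μ)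
      (fun a b h => h.2.2) hfin (g := g) (fun v => rfl) hH hfreq hmax hne
      (r := fun i => (π i).1.2.1) (p := fun i => posPriority (π i).1.1.2)
      (fun i => val_posPriority _) (fun i => (hπ i).2.1)
    exact ⟨p, (RegPos.limit_regOutput (fun i => (hH i).1) (fun i => (hπ i).2) p).2 hp, he⟩
  obtain ⟨ν, hν⟩ := exists_progress
    (R := fun x y : X => H x.1.1 y.1.1 ∧ x.1.Follows (g x.1.1) y.1)
    (pr := fun x => x.1.regOutput) hpath
  have hprio : (fun x : X => ((A.registerVersion k).acceptanceGame S).priority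
      (x.1.after (g x.1.1))) = fun x => x.1.regOutput := by
    funext x
    obtain ⟨⟨⟨u, q | b⟩, r, o⟩, hx⟩ := x <;> rfl
  have hnext : ∀ (x : X) c, H x.1.1 c → ∃ y : X,
      ((A.registerVersion k).acceptanceGame S).EveReach (x.1.next (g x.1.1) c).before
        (y.1.after (g y.1.1)) ∧
      Progress (fun x : X => ((A.registerVersion k).acceptanceGame S).priority
        (x.1.after (g x.1.1))) ν x y := by
    intro x c hc
    refine ⟨⟨x.1.next (g x.1.1) c, hc.2.1⟩, RegPos.eveReach_after _ _, ?_⟩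
    rw [hprio]
    exact hν _ _ ⟨hc, rfl, rfl⟩
  refine ((A.registerVersion k).acceptanceGame S).eveWinsFrom_of_progress (X := X)
    (fun x => x.1.after (g x.1.1)) ν (fun x hx => ?_) (fun x hx b hb => ?_)
    (x := ⟨((S.root, .inl A.init), fun _ => 0, 0), h₀⟩) .refl
  · obtain ⟨⟨⟨u, q | ⟨⟨m, q⟩⟩ | ⟨b, b'⟩ | ⟨b, b'⟩⟩, r, o⟩, hxW⟩ := x
    · obtain ⟨c, hc, hm, hpr⟩ := heve _ hxW trivial
      obtain ⟨y, hy⟩ := hnext ⟨_, hxW⟩ c ⟨hm, hc, hpr⟩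
      cases hm
      exact ⟨_, y, .state _ _, ((A.registerVersion k).eveReach_bigOr S u k _ _).trans hy.1, hy.2⟩
    · cases m
      · obtain ⟨c, hc, hm, hpr⟩ := heve _ hxW trivial
        obtain ⟨y, hy⟩ := hnext ⟨_, hxW⟩ c ⟨hm, hc, hpr⟩
        cases hm with
        | child _ _ _ _ hadj => exact ⟨_, y, .child _ _ _ _ hadj, hy⟩
      · exact hx.elim
    · exact hx.elim
    · obtain ⟨c, hc, hm, hpr⟩ := heve _ hxW trivial
      obtain ⟨y, hy⟩ := hnext ⟨_, hxW⟩ c ⟨hm, hc, hpr⟩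
      cases hm with
      | or_left => exact ⟨_, y, .or_left _ _ _, hy⟩
      | or_right => exact ⟨_, y, .or_right _ _ _, hy⟩
  · obtain ⟨⟨⟨u, q | ⟨⟨m, q⟩⟩ | ⟨b₁, b₂⟩ | ⟨b₁, b₂⟩⟩, r, o⟩, hxW⟩ := x
    · exact absurd trivial hx
    · cases m
      · exact absurd trivial hx
      · cases hb with
        | child _ y _ _ hadj =>
          have hm : A.Move S (u, .inr (.atom (.box, q))) (y, .inl q) := .child _ _ _ _ hadj
          exact hnext ⟨_, hxW⟩ _ ⟨hm, hadam _ hxW id _ hm⟩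
    · cases hb with
      | and_left =>
        have hm : A.Move S (u, .inr (.and b₁ b₂)) (u, .inr b₁) := .and_left _ _ _
        exact hnext ⟨_, hxW⟩ _ ⟨hm, hadam _ hxW id _ hm⟩
      | and_right =>
        have hm : A.Move S (u, .inr (.and b₁ b₂)) (u, .inr b₂) := .and_right _ _ _
        exact hnext ⟨_, hxW⟩ _ ⟨hm, hadam _ hxW id _ hm⟩
    · exact absurd trivial hx

end APT

theorem mainTheorem4 {α : Type u} [Finite α] (A : APT.{u, v} α) (d k : ℕ)
    (hk : k = 1 + Nat.log 2 (d * A.numStates)) :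
    (A.registerVersion k).numPriorities = 2 * k + 2 ∧
    ∀ S : LabelledGraph.{u, w} α, Finite S.V → S.SCCsHaveFvsSizeAtMost d →
      (A.Accepts S ↔ (A.registerVersion k).Accepts S) := by
  refine ⟨rfl, fun S _ hS => ?_⟩
  unfold APT.Accepts
  -- Only the forward implication uses finiteness and the feedback bound.
  refine ⟨fun h => ?_, APT.acceptsTree_of_registerVersion⟩
  rw [APT.acceptsTree_unfolding] at h ⊢
  refine APT.registerVersion_acceptsTree hS ?_ h
  rw [hk, add_comm]
  -- This includes `d n = 0`, where the logarithm is `0` and `k = 1`.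
  exact Nat.lt_pow_succ_log_self one_lt_two _
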